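/- **Theorem ($L^p$-almost-periodicity relative to a Bohr set).** *Conventions.* Let $G$ be a finite abelian group with dual group $\widehat G$ (the homomorphisms $G\to\mathbb{C}^\times$). A Bohr set $B$ is given by a set $\Gamma\subset\widehat G$ and a radius $\rho\ge 0$; its elements are the $x\in G$ with $|\gamma(x)-1|\le\rho$ for all $\gamma\in\Gamma$, and its rank is $|\Gamma|$. For $\tau\ge 0$, $B_\tau$ is the Bohr set with the same $\Gamma$ and radius $\tau\rho$. For Bohr sets $T$ with data $(\Lambda,\sigma)$ and $B$ with data $(\Gamma,\rho)$, $T\le B$ means $\Lambda\supset\Gamma$ and $\sigma\le\rho$. A Bohr set $B$ of rank $d$ is regular if $1-12d|\tau|\le |B_{1+\tau}|/|B|\le 1+12d|\tau|$ whenever $|\tau|\le 1/(12d)$. For a finite nonempty set $X \subset G$ write $1_X$ for its indicator function, $\mu_X=1_X/|X|$, $\mu_X(Y)=|Y|/|X|$ for $Y \subset X$, and $\|f\|_{L^p(X)}=\bigl(\frac1{|X|}\sum_{x\in X}|f(x)|^p\bigr)^{1/p}$; and $f*g(x)=\sum_y f(y)g(x-y)$. *Statement.* There are absolute constants $c,C>0$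 such that the following holds. Let $m\ge 1$ be real and $\epsilon,\delta\in(0,1)$. Let $A,L$ be nonempty subsets of a finite abelian group $G$ with $\eta:=|A|/|L|\le 1$, and let $B\subset G$ be a regular Bohr set of rank $d\ge 1$ and radius $\rho\le 2$. Let $\tau\ge 0$ satisfy $$\tau\le\frac{(c\delta)^{2m}}{d\log(2/\delta\eta)},$$ suppose that $B_\tau$ is regular, and suppose that $|A+S|\le K|A|$ for a nonempty subset $S\subset B_\tau$. Then there are a real number $d'>0$ with $$d'\le C\left(m\epsilon^{-2}\log^2(2/\delta\eta)\log(2K)+\log\bigl(1/\mu_{B_\tau}(S)\bigr)\right)$$ and a regular Bohr set $T\le B_\tau$ of rank at most $d+d'$ and radius at least $\rho\tau\delta\eta^{1/2}/(d^2d')$ such that, with $f=\mu_A*1_L\cdot(1-\mu_A*1_L)$, for every $t\in T$, $$\|\mu_A*1_L(\cdot+t)-\mu_A*1_L\|_{L^{2m}(B)}\le\epsilon\|f\|_{L^m(B)}^{1/2}+\epsilon^{2-1/m}\|f\|_{L^1(B)}^{1/2m}+\delta,$$ and moreover $$\|\mu_A*1_L*\mu_T-\mu_A*1_L\|_{L^{2m}(B)}\le\epsilon\|f\|_{L^m(B)}^{1/2}+\epsilon^{2-1/m}\|f\|_{L^1(B)}^{1/2m}+\delta.$$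 -/

import Mathlib

open scoped NNReal Pointwise

noncomputable section

/-- A Bohr set in `G`, with its defining data: a finite set of characters (the frequencies) and a
radius `ρ ≥ 0`. -/
structure BohrSet (G : Type*) [AddCommGroup G] where
  freq : Finset (AddChar G ℂ)
  radius : ℝ≥0

namespace BohrSet

variable {G : Type*} [AddCommGroup G]

/-- The rank of a Bohr set is the number of its frequencies. -/
def rank (B : BohrSet G) : ℕ := B.freq.card

open Classical in
/-- The underlying set `{x ∈ G : |γ(x) - 1| ≤ ρ for all γ ∈ Γ}`. -/
def carrier [Fintype G] (B : BohrSet G) : Finset G :=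
  Finset.univ.filter fun x => ∀ γ ∈ B.freq, ‖γ x - 1‖ ≤ (B.radius : ℝ)

/-- The Bohr set `B_τ` with the same frequencies and the radius multiplied by `τ`. -/
def dilate (B : BohrSet G) (τ : ℝ≥0) : BohrSet G := ⟨B.freq, τ * B.radius⟩

/-- `T.IsSub B` says that `T` is a sub-Bohr set of `B`, written `T ≤ B`. -/
def IsSub (T B : BohrSet G) : Prop := B.freq ⊆ T.freq ∧ T.radius ≤ B.radius

/-- Regularity of a Bohr set of rank `d`:
`1 - 12 d |τ| ≤ |B_{1+τ}| / |B| ≤ 1 + 12 d |τ|` whenever `|τ| ≤ 1 / (12 d)`. -/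
def IsRegular [Fintype G] (B : BohrSet G) : Prop :=
  ∀ τ : ℝ, |τ| ≤ 1 / (12 * (B.rank : ℝ)) →
    1 - 12 * (B.rank : ℝ) * |τ|
        ≤ ((B.dilate (1 + τ).toNNReal).carrier.card : ℝ) / (B.carrier.card : ℝ) ∧
      ((B.dilate (1 + τ).toNNReal).carrier.card : ℝ) / (B.carrier.card : ℝ)
        ≤ 1 + 12 * (B.rank : ℝ) * |τ|

end BohrSet

/-- The indicator function `1_X`. -/
def indFun {G : Type*} (X : Finset G) : G → ℝ := Set.indicator (X : Set G) 1

/-- The normalised indicator function `μ_X = 1_X / |X|`. -/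
def muFun {G : Type*} (X : Finset G) : G → ℝ := fun x => indFun X x / (X.card : ℝ)

/-- The convolution `f * g (x) = ∑ y, f(y) g(x - y)`. -/
def conv {G : Type*} [AddCommGroup G] [Fintype G] (f g : G → ℝ) : G → ℝ :=
  fun x => ∑ y, f y * g (x - y)

/-- The norm `‖f‖_{L^p(X)} = (𝔼_{x ∈ X} |f(x)|^p)^{1/p}`, for a finite set `X` and real `p`. -/
def avgLpNorm {G : Type*} (p : ℝ) (X : Finset G) (f : G → ℝ) : ℝ :=
  ((∑ x ∈ X, |f x| ^ p) / (X.card : ℝ)) ^ (1 / p)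

end

/-! The argument is Croot–Sisask sampling followed by Fourier bootstrapping, localised to a Bohr
set. Write `g` for `μ_A * 1_L`. At each point, `g` is the mean of `1_L (x - a)` over `a ∈ A`, with
variance `f x = g x (1 - g x)`. Hence the average over `n ≈ m / ε²` random samples has `2m`-th
moment error controlled by `f`, and at least half of the `n`-tuples from `A` give a good
approximation in `L^{2m}(B)`. Since `|A + S| ≤ K|A|`, pigeonholing over `(A + S)^n` finds one tuple
with good translates by at least `|S| / (2 K^n)` elements of `S`. Translating a tuple translates its
average, so these elements form a set `X` for which a single function `F`, shifted by any `s ∈ X`,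
approximates `g` (`exists_translates_approx`).

Consequently `g` is almost invariant under `X - X`, and so is close to its `k`-fold average over
such differences. That average multiplies the Fourier coefficient at `γ` by `‖muHat X γ‖^{2k}`,
which is negligible off the large spectrum of `X` once `k ≈ log (2/δη)`. As the coefficients of `g`
have `ℓ¹` norm at most `η^{-1/2}`, the average is uniformly almost invariant under any `t` that
almost annihilates the large spectrum (`abs_diffAverage_iterate_sub_le`). Passing from the average
back to `g` costs a factor `O(k)`, which sampling at accuracy `ε / (8k)` absorbs, and a boundary
layer of `B`, which regularity and the size of `τ` make small (`lpSum_translate_sub_le`).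

It remains to find a Bohr set of such `t`. A local Chang theorem (`exists_almost_annihilating`) adds
`O(log (|B_τ| / |X|))` frequencies, namely a maximal set in the large spectrum dissociated relative
to a small Bohr set `V`. Its size is bounded by a Riesz product against a majorant of `1_X`
(`card_le_of_isDissociatedRel`). Regular radii exist at every small scale by a Vitali covering
argument (`BohrSet.exists_isRegular`). -/

/-- The unnormalised norm `(∑ x ∈ X, |f x| ^ p) ^ (1 / p)`. -/
noncomputable def lpSum {G : Type*} (p : ℝ) (X : Finset G) (f : G → ℝ) : ℝ :=
  (∑ x ∈ X, |f x| ^ p) ^ (1 / p)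

/-! ### Elementary properties of unnormalised `ℓ^p` norms. -/

section lpSum

variable {G : Type*}

theorem sum_abs_rpow_nonneg (p : ℝ) (X : Finset G) (f : G → ℝ) : 0 ≤ ∑ x ∈ X, |f x| ^ p :=
  Finset.sum_nonneg fun _ _ => Real.rpow_nonneg (abs_nonneg _) _

theorem lpSum_nonneg (p : ℝ) (X : Finset G) (f : G → ℝ) : 0 ≤ lpSum p X f :=
  Real.rpow_nonneg (sum_abs_rpow_nonneg _ _ _) _

theorem avgLpNorm_eq (p : ℝ) (X : Finset G) (f : G → ℝ) :
    avgLpNorm p X f = lpSum p X f / (X.card : ℝ) ^ (1 / p) := by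
  unfold avgLpNorm lpSum
  rw [Real.div_rpow (sum_abs_rpow_nonneg _ _ _) (Nat.cast_nonneg _)]

theorem lpSum_add_le {p : ℝ} (hp : 1 ≤ p) (X : Finset G) (f g : G → ℝ) :
    lpSum p X (fun x => f x + g x) ≤ lpSum p X f + lpSum p X g :=
  Real.Lp_add_le X f g hp

theorem lpSum_congr {p : ℝ} {X : Finset G} {f g : G → ℝ} (h : ∀ x ∈ X, |f x| = |g x|) :
    lpSum p X f = lpSum p X g := by
  unfold lpSum
  congr 1
  exact Finset.sum_congr rfl fun x hx => by rw [h x hx]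

theorem lpSum_mono {p : ℝ} (hp : 0 ≤ p) {X Y : Finset G} (h : X ⊆ Y) (f : G → ℝ) :
    lpSum p X f ≤ lpSum p Y f := by
  unfold lpSum
  refine Real.rpow_le_rpow (sum_abs_rpow_nonneg _ _ _) ?_ (by positivity)
  exact Finset.sum_le_sum_of_subset_of_nonneg h fun _ _ _ => Real.rpow_nonneg (abs_nonneg _) _

theorem lpSum_comp_le {p : ℝ} (hp : 0 ≤ p) {X Y : Finset G} (e : G → G)
    (he : Function.Injective e) (h : ∀ x ∈ X, e x ∈ Y) (f : G → ℝ) :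
    lpSum p X (fun x => f (e x)) ≤ lpSum p Y f := by
  classical
  unfold lpSum
  refine Real.rpow_le_rpow (sum_abs_rpow_nonneg _ _ _) ?_ (by positivity)
  rw [← Finset.sum_image (f := fun y => |f y| ^ p) (fun x _ y _ hxy => he hxy)]
  refine Finset.sum_le_sum_of_subset_of_nonneg ?_ fun _ _ _ => Real.rpow_nonneg (abs_nonneg _) _
  intro y hy
  obtain ⟨x, hx, rfl⟩ := Finset.mem_image.mp hy
  exact h x hx

theorem lpSum_zero {p : ℝ} (hp : 0 < p) (X : Finset G) : lpSum p X (fun _ => 0) = 0 := by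
  unfold lpSum
  simp only [abs_zero, Real.zero_rpow hp.ne', Finset.sum_const_zero]
  exact Real.zero_rpow (by positivity)

theorem lpSum_const_mul {p : ℝ} (hp : 0 < p) (X : Finset G) (c : ℝ) (f : G → ℝ) :
    lpSum p X (fun x => c * f x) = |c| * lpSum p X f := by
  unfold lpSum
  have : ∀ x, |c * f x| ^ p = |c| ^ p * |f x| ^ p := fun x => by
    rw [abs_mul, Real.mul_rpow (abs_nonneg _) (abs_nonneg _)]
  simp only [this]
  rw [← Finset.mul_sum, Real.mul_rpow (Real.rpow_nonneg (abs_nonneg _) _)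
    (sum_abs_rpow_nonneg _ _ _), ← Real.rpow_mul (abs_nonneg _), mul_one_div_cancel hp.ne',
    Real.rpow_one]

theorem lpSum_sum_le {p : ℝ} (hp : 1 ≤ p) (X : Finset G) {ι : Type*} (I : Finset ι)
    (h : ι → G → ℝ) : lpSum p X (fun x => ∑ i ∈ I, h i x) ≤ ∑ i ∈ I, lpSum p X (h i) := by
  classical
  induction I using Finset.induction_on with
  | empty => simp [lpSum_zero (by linarith : 0 < p)]
  | insert a I ha ih =>
    simp only [Finset.sum_insert ha]
    exact (lpSum_add_le hp X _ _).trans (by gcongr)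

/-- The `ℓ^p` norm of an average is at most the largest of the `ℓ^p` norms. -/
theorem lpSum_average_le {p : ℝ} (hp : 1 ≤ p) (X : Finset G) {ι : Type*} {I : Finset ι}
    (hI : I.Nonempty) (h : ι → G → ℝ) {D : ℝ} (hD : ∀ i ∈ I, lpSum p X (h i) ≤ D) :
    lpSum p X (fun x => (∑ i ∈ I, h i x) / (I.card : ℝ)) ≤ D := by
  have hc : (0 : ℝ) < I.card := by exact_mod_cast hI.card_pos
  have h1 : lpSum p X (fun x => (∑ i ∈ I, h i x) / (I.card : ℝ))
      = (I.card : ℝ)⁻¹ * lpSum p X (fun x => ∑ i ∈ I, h i x) := by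
    rw [← abs_of_pos (inv_pos.mpr hc), ← lpSum_const_mul (by linarith)]
    congr 1
    funext x
    rw [div_eq_inv_mul]
  rw [h1, inv_mul_le_iff₀ hc]
  refine (lpSum_sum_le hp X I h).trans ((Finset.sum_le_sum hD).trans ?_)
  simp

theorem lpSum_le_of_abs_le {p : ℝ} (hp : 0 < p) {X : Finset G} {f : G → ℝ} {a : ℝ} (ha : 0 ≤ a)
    (h : ∀ x ∈ X, |f x| ≤ a) : lpSum p X f ≤ a * (X.card : ℝ) ^ (1 / p) := by
  unfold lpSum
  have h1 : ∑ x ∈ X, |f x| ^ p ≤ a ^ p * X.card := by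
    calc ∑ x ∈ X, |f x| ^ p ≤ ∑ x ∈ X, a ^ p :=
          Finset.sum_le_sum fun x hx => Real.rpow_le_rpow (abs_nonneg _) (h x hx) hp.le
      _ = a ^ p * X.card := by simp [mul_comm]
  refine (Real.rpow_le_rpow (sum_abs_rpow_nonneg _ _ _) h1 (by positivity)).trans ?_
  rw [Real.mul_rpow (by positivity) (by positivity), ← Real.rpow_mul ha,
    mul_one_div_cancel hp.ne', Real.rpow_one]

theorem lpSum_le_add_sdiff [DecidableEq G] {p : ℝ} (hp : 1 ≤ p) (X Y : Finset G) (f : G → ℝ) :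
    lpSum p X f ≤ lpSum p Y f + lpSum p (X \ Y) f := by
  have hp0 : 0 < p := by linarith
  unfold lpSum
  have h1 : ∑ x ∈ X, |f x| ^ p ≤ ∑ x ∈ Y, |f x| ^ p + ∑ x ∈ X \ Y, |f x| ^ p := by
    have h2 : ∑ x ∈ X, |f x| ^ p ≤ ∑ x ∈ Y ∪ (X \ Y), |f x| ^ p := by
      refine Finset.sum_le_sum_of_subset_of_nonneg ?_
        fun _ _ _ => Real.rpow_nonneg (abs_nonneg _) _
      intro x hx
      by_cases hy : x ∈ Y <;> simp [hx, hy]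
    rwa [Finset.sum_union Finset.disjoint_sdiff] at h2
  refine (Real.rpow_le_rpow (sum_abs_rpow_nonneg _ _ _) h1 (by positivity)).trans ?_
  refine Real.rpow_add_le_add_rpow (sum_abs_rpow_nonneg _ _ _) (sum_abs_rpow_nonneg _ _ _)
    (by positivity) ?_
  rw [div_le_one hp0]; exact hp

end lpSum

/-! ### Moments of sums of independent bounded variables. -/

section moments

/-- For `y ≤ 1` compare with `y²`; for `y ≥ 1` raise `y / p ≤ exp (y / p)` to the power `p`. Using
`cosh y - 1` instead of `cosh y` lets the resulting moment bounds vanish with the variance. -/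
theorem rpow_le_mul_cosh_sub_one {p : ℝ} (hp : 2 ≤ p) {y : ℝ} (hy : 0 ≤ y) :
    y ^ p ≤ 8 * p ^ p * (Real.cosh y - 1) := by
  have hp0 : 0 < p := by linarith
  have hpp : (1 : ℝ) ≤ p ^ p := Real.one_le_rpow (by linarith) hp0.le
  rcases le_total y 1 with h1 | h1
  · have h2 : y ^ p ≤ y ^ 2 := by
      rw [← Real.rpow_natCast]
      exact Real.rpow_le_rpow_of_exponent_ge_of_imp hy h1 (by exact_mod_cast hp) (by
        intro _ h; exact absurd h hp0.ne')
    have h3 : 1 + y ^ 2 / 2 ≤ Real.cosh y := by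
      have h4 : y / 2 ≤ Real.sinh (y / 2) := Real.self_le_sinh_iff.mpr (by positivity)
      have h5 : Real.cosh y = Real.cosh (y / 2) ^ 2 + Real.sinh (y / 2) ^ 2 := by
        rw [← Real.cosh_two_mul]; congr 1; ring
      rw [h5, Real.cosh_sq]
      nlinarith
    nlinarith [mul_le_mul_of_nonneg_right hpp (by nlinarith [sq_nonneg y] : 0 ≤ Real.cosh y - 1)]
  · have h2 : y ^ p ≤ p ^ p * Real.exp y := by
      have h3 : y / p ≤ Real.exp (y / p) := by
        have := Real.add_one_le_exp (y / p); linarith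
      have h4 := Real.rpow_le_rpow (by positivity) h3 hp0.le
      rw [Real.div_rpow hy hp0.le, ← Real.exp_mul, div_mul_cancel₀ _ hp0.ne',
        div_le_iff₀ (by positivity)] at h4
      linarith
    have h5 : Real.exp y ≤ 8 * (Real.cosh y - 1) := by
      rw [Real.cosh_eq]
      have h6 : Real.exp y * Real.exp (-y) = 1 := by rw [← Real.exp_add]; simp
      have h7 : 2.7 ≤ Real.exp y := by
        have := Real.exp_one_gt_d9
        have := Real.exp_le_exp.mpr h1
        linarith
      nlinarith [Real.exp_pos (-y)]
    calc y ^ p ≤ p ^ p * Real.exp y := h2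
      _ ≤ p ^ p * (8 * (Real.cosh y - 1)) := by gcongr
      _ = _ := by ring

/-- Because `exp y ≤ 1 + y + y²` for `|y| ≤ 1`, and the linear term averages to zero. -/
theorem sum_exp_le_of_sum_eq_zero {α : Type*} {A : Finset α} (v : α → ℝ) (hv : ∀ a ∈ A, |v a| ≤ 1)
    (h0 : ∑ a ∈ A, v a = 0) {σ : ℝ} (h2 : ∑ a ∈ A, v a ^ 2 = A.card * σ) {t : ℝ} (ht : |t| ≤ 1) :
    ∑ a ∈ A, Real.exp (t * v a) ≤ A.card * Real.exp (t ^ 2 * σ) := by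
  have h1 : ∀ a ∈ A, Real.exp (t * v a) ≤ 1 + t * v a + t ^ 2 * v a ^ 2 := by
    intro a ha
    have h3 : |t * v a| ≤ 1 := by
      rw [abs_mul]
      exact mul_le_one₀ ht (abs_nonneg _) (hv a ha)
    have := (abs_le.mp (Real.abs_exp_sub_one_sub_id_le h3)).2
    rw [mul_pow] at this
    linarith
  calc ∑ a ∈ A, Real.exp (t * v a) ≤ ∑ a ∈ A, (1 + t * v a + t ^ 2 * v a ^ 2) :=
        Finset.sum_le_sum h1
    _ = A.card * (1 + t ^ 2 * σ) := by
        rw [Finset.sum_add_distrib, Finset.sum_add_distrib, ← Finset.mul_sum, ← Finset.mul_sum, h0,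
          h2]
        simp; ring
    _ ≤ A.card * Real.exp (t ^ 2 * σ) := by
        gcongr
        have := Real.add_one_le_exp (t ^ 2 * σ); linarith

theorem sum_piFinset_exp_le {α : Type*} {A : Finset α} (v : α → ℝ) (hv : ∀ a ∈ A, |v a| ≤ 1)
    (h0 : ∑ a ∈ A, v a = 0) {σ : ℝ} (h2 : ∑ a ∈ A, v a ^ 2 = A.card * σ) {t : ℝ} (ht : |t| ≤ 1)
    (n : ℕ) :
    ∑ a ∈ Fintype.piFinset fun _ : Fin n => A, Real.exp (t * ∑ i, v (a i))
      ≤ (A.card : ℝ) ^ n * Real.exp (t ^ 2 * (n * σ)) := by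
  have h1 : ∑ a ∈ Fintype.piFinset fun _ : Fin n => A, Real.exp (t * ∑ i, v (a i))
      = (∑ a ∈ A, Real.exp (t * v a)) ^ n := by
    rw [Finset.sum_pow']
    refine Finset.sum_congr rfl fun a _ => ?_
    rw [Finset.mul_sum, Real.exp_sum]
  rw [h1]
  refine (pow_le_pow_left₀ (Finset.sum_nonneg fun _ _ => (Real.exp_pos _).le)
    (sum_exp_le_of_sum_eq_zero v hv h0 h2 ht) n).trans (le_of_eq ?_)
  rw [mul_pow, ← Real.exp_nat_mul]
  ring_nf

/-- A bound for the moments of a sum of independent centred bounded variables in terms of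
an exponential parameter. -/
theorem sum_piFinset_rpow_le_exp {α : Type*} {A : Finset α} (v : α → ℝ) (hv : ∀ a ∈ A, |v a| ≤ 1)
    (h0 : ∑ a ∈ A, v a = 0) {σ : ℝ} (h2 : ∑ a ∈ A, v a ^ 2 = A.card * σ) {t : ℝ} (ht0 : 0 < t)
    (ht : t ≤ 1) (n : ℕ) {p : ℝ} (hp : 2 ≤ p) :
    ∑ a ∈ Fintype.piFinset fun _ : Fin n => A, |∑ i, v (a i)| ^ p
      ≤ (A.card : ℝ) ^ n * (8 * (p / t) ^ p * (Real.exp (t ^ 2 * (n * σ)) - 1)) := by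
  have hp0 : 0 < p := by linarith
  have h1 : ∀ y : ℝ, |y| ^ p ≤ 8 * (p / t) ^ p *
      ((Real.exp (t * y) + Real.exp ((-t) * y)) / 2 - 1) := by
    intro y
    have h3 := rpow_le_mul_cosh_sub_one hp (by positivity : 0 ≤ t * |y|)
    have h4 : Real.cosh (t * |y|) = (Real.exp (t * y) + Real.exp ((-t) * y)) / 2 := by
      rw [← abs_of_pos ht0, ← abs_mul, Real.cosh_abs, Real.cosh_eq, abs_of_pos ht0, neg_mul]
    rw [Real.mul_rpow ht0.le (abs_nonneg _), h4] at h3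
    rw [Real.div_rpow hp0.le ht0.le]
    have htp : 0 < t ^ p := by positivity
    calc |y| ^ p = (t ^ p * |y| ^ p) / t ^ p := by field_simp
      _ ≤ (8 * p ^ p * ((Real.exp (t * y) + Real.exp ((-t) * y)) / 2 - 1)) / t ^ p := by gcongr
      _ = _ := by ring
  have h5 := sum_piFinset_exp_le v hv h0 h2 (t := t) (by rwa [abs_of_pos ht0]) n
  have h6 := sum_piFinset_exp_le v hv h0 h2 (t := -t) (by rwa [abs_neg, abs_of_pos ht0]) n
  rw [neg_sq] at h6
  calc ∑ a ∈ Fintype.piFinset fun _ : Fin n => A, |∑ i, v (a i)| ^ p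
      ≤ ∑ a ∈ Fintype.piFinset fun _ : Fin n => A, 8 * (p / t) ^ p *
        ((Real.exp (t * ∑ i, v (a i)) + Real.exp ((-t) * ∑ i, v (a i))) / 2 - 1) :=
        Finset.sum_le_sum fun a _ => h1 _
    _ = 8 * (p / t) ^ p *
        ((∑ a ∈ Fintype.piFinset fun _ : Fin n => A, Real.exp (t * ∑ i, v (a i))
          + ∑ a ∈ Fintype.piFinset fun _ : Fin n => A, Real.exp ((-t) * ∑ i, v (a i))) / 2
          - (A.card : ℝ) ^ n) := by
        rw [← Finset.mul_sum, Finset.sum_sub_distrib, ← Finset.sum_div, Finset.sum_add_distrib]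
        simp
    _ ≤ 8 * (p / t) ^ p * ((A.card : ℝ) ^ n * Real.exp (t ^ 2 * (n * σ)) - (A.card : ℝ) ^ n) := by
        gcongr
        linarith
    _ = _ := by ring

/-- The exponential parameter is chosen according to the total variance `nσ`. If `nσ ≥ m`, taking `t
= √(m / nσ)` makes the exponent `m` and gives the Gaussian term. If `nσ ≤ m`, the choice is `t = 1`,
and `exp (nσ) - 1 ≤ nσ exp m` gives the term linear in the variance. -/
theorem sum_piFinset_rpow_le {α : Type*} {A : Finset α} (v : α → ℝ) (hv : ∀ a ∈ A, |v a| ≤ 1)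
    (h0 : ∑ a ∈ A, v a = 0) {σ : ℝ} (hσ : 0 ≤ σ) (h2 : ∑ a ∈ A, v a ^ 2 = A.card * σ)
    (n : ℕ) {m : ℝ} (hm : 1 ≤ m) :
    ∑ a ∈ Fintype.piFinset fun _ : Fin n => A, |∑ i, v (a i)| ^ (2 * m)
      ≤ (A.card : ℝ) ^ n * (8 * (12 * m * (n * σ)) ^ m + 8 * (12 * m ^ 2) ^ m * (n * σ)) := by
  have hm0 : 0 < m := by linarith
  have hs0 : 0 ≤ n * σ := by positivity
  have he : Real.exp 1 ≤ 3 := by have := Real.exp_one_lt_d9; linarith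
  have hem : Real.exp m ≤ 3 ^ m := by
    rw [← one_mul m, Real.exp_mul, one_mul]
    exact Real.rpow_le_rpow (Real.exp_pos _).le he hm0.le
  have h4 : (2 * m) ^ (2 * m) = (4 * m ^ 2) ^ m := by
    rw [Real.rpow_mul (by positivity)]
    congr 1
    rw [Real.rpow_two]; ring
  rcases le_total (n * σ) m with hs | hs
  · have h1 := sum_piFinset_rpow_le_exp v hv h0 h2 one_pos le_rfl n
      (by linarith : (2 : ℝ) ≤ 2 * m)
    refine h1.trans ?_
    gcongr
    rw [div_one, one_pow, one_mul]
    have h3 : Real.exp (n * σ) - 1 ≤ (n * σ) * Real.exp m := by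
      have h5 : 1 - n * σ ≤ Real.exp (-(n * σ)) := by
        have := Real.add_one_le_exp (-(n * σ)); linarith
      have h6 : Real.exp (n * σ) * Real.exp (-(n * σ)) = 1 := by rw [← Real.exp_add]; simp
      have h7 : Real.exp (n * σ) ≤ Real.exp m := Real.exp_le_exp.mpr hs
      have h8 := mul_le_mul_of_nonneg_left h5 (Real.exp_pos (n * σ)).le
      have h9 := mul_le_mul_of_nonneg_left h7 hs0
      nlinarith
    have h10 : 0 ≤ 8 * (12 * m * (n * σ)) ^ m := by positivity
    have h11 : 8 * (2 * m) ^ (2 * m) * (Real.exp (n * σ) - 1)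
        ≤ 8 * (12 * m ^ 2) ^ m * (n * σ) := by
      calc 8 * (2 * m) ^ (2 * m) * (Real.exp (n * σ) - 1)
          ≤ 8 * (2 * m) ^ (2 * m) * ((n * σ) * 3 ^ m) := by
            gcongr
            exact h3.trans (by gcongr)
        _ = 8 * ((4 * m ^ 2) ^ m * 3 ^ m) * (n * σ) := by rw [h4]; ring
        _ = _ := by
            rw [← Real.mul_rpow (by positivity) (by positivity)]
            ring_nf
    linarith
  · have hs1 : 0 < n * σ := by linarith
    have ht0 : 0 < Real.sqrt (m / (n * σ)) := Real.sqrt_pos.mpr (by positivity)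
    have h1 := sum_piFinset_rpow_le_exp v hv h0 h2 ht0
      (Real.sqrt_le_one.mpr ((div_le_one hs1).mpr hs)) n (by linarith : (2 : ℝ) ≤ 2 * m)
    refine h1.trans ?_
    gcongr
    rw [Real.sq_sqrt (by positivity), div_mul_cancel₀ _ hs1.ne']
    have h5 : (2 * m / Real.sqrt (m / (n * σ))) ^ (2 * m) = (4 * m * (n * σ)) ^ m := by
      rw [Real.rpow_mul (by positivity)]
      congr 1
      rw [Real.rpow_two, div_pow, Real.sq_sqrt (by positivity)]
      field_simp
      ring
    rw [h5]
    have h10 : 0 ≤ 8 * (12 * m ^ 2) ^ m * (n * σ) := by positivity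
    have h11 : 8 * (4 * m * (n * σ)) ^ m * (Real.exp m - 1) ≤ 8 * (12 * m * (n * σ)) ^ m := by
      calc 8 * (4 * m * (n * σ)) ^ m * (Real.exp m - 1)
          ≤ 8 * (4 * m * (n * σ)) ^ m * 3 ^ m := by
            gcongr
            linarith
        _ = 8 * ((4 * m * (n * σ)) ^ m * 3 ^ m) := by ring
        _ = _ := by
            rw [← Real.mul_rpow (by positivity) (by positivity)]
            ring_nf
    linarith

/-- The moments of the error in estimating a mean by the average of `n` random samples. -/
theorem sum_piFinset_average_rpow_le {α : Type*} {A : Finset α} (v : α → ℝ)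
    (hv : ∀ a ∈ A, |v a| ≤ 1) (h0 : ∑ a ∈ A, v a = 0) {σ : ℝ} (hσ : 0 ≤ σ)
    (h2 : ∑ a ∈ A, v a ^ 2 = A.card * σ) {n : ℕ} {m : ℝ} (hm : 1 ≤ m) {ε : ℝ} (hε : 0 < ε)
    (hn : 192 * m ≤ n * ε ^ 2) :
    ∑ a ∈ Fintype.piFinset fun _ : Fin n => A, |(∑ i, v (a i)) / n| ^ (2 * m)
      ≤ (A.card : ℝ) ^ n * (ε ^ (2 * m) * σ ^ m + ε ^ (4 * m - 2) * σ) := by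
  have hm0 : 0 < m := by linarith
  have hn0 : (0 : ℝ) < n := by
    rcases Nat.eq_zero_or_pos n with h | h
    · subst h; norm_num at hn; linarith
    · exact_mod_cast h
  have hq : 192 * (m / n) ≤ ε ^ 2 := by
    rw [← mul_div_assoc, div_le_iff₀ hn0]; linarith
  have hn2 : ((n : ℝ)) ^ (2 * m) = ((n : ℝ) ^ 2) ^ m := by
    rw [Real.rpow_mul hn0.le, Real.rpow_two]
  have h1 : ∀ a : Fin n → α, |(∑ i, v (a i)) / n| ^ (2 * m)
      = |∑ i, v (a i)| ^ (2 * m) / ((n : ℝ) ^ 2) ^ m := by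
    intro a
    rw [abs_div, abs_of_pos hn0, Real.div_rpow (abs_nonneg _) hn0.le, hn2]
  simp only [h1]
  rw [← Finset.sum_div, div_le_iff₀ (by positivity)]
  refine (sum_piFinset_rpow_le v hv h0 hσ h2 n hm).trans ?_
  rw [mul_assoc ((A.card : ℝ) ^ n)]
  refine mul_le_mul_of_nonneg_left ?_ (by positivity)
  rw [add_mul]
  have h8 : (8 : ℝ) ≤ 8 ^ m := by
    have := Real.rpow_le_rpow_of_exponent_le (by norm_num : (1 : ℝ) ≤ 8) hm
    simpa using this
  refine add_le_add ?_ ?_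
  · calc 8 * (12 * m * (n * σ)) ^ m ≤ 8 ^ m * (12 * m * (n * σ)) ^ m := by gcongr
      _ = (96 * (m / n) * σ * n ^ 2) ^ m := by
          rw [← Real.mul_rpow (by positivity) (by positivity)]
          congr 1
          field_simp
          ring
      _ ≤ (ε ^ 2 * σ * n ^ 2) ^ m := by
          gcongr
          have : 0 ≤ m / n := by positivity
          linarith
      _ = ε ^ (2 * m) * σ ^ m * ((n : ℝ) ^ 2) ^ m := by
          rw [Real.mul_rpow (by positivity) (by positivity),
            Real.mul_rpow (by positivity) (by positivity), Real.rpow_mul hε.le, Real.rpow_two]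
  · have hm2 : m ≤ 2 ^ m := by
      have := one_add_mul_self_le_rpow_one_add (by norm_num : (-1 : ℝ) ≤ 1) hm
      norm_num at this
      linarith
    -- The power `(m / n)^(2m - 1)` is isolated because `192 m / n ≤ ε²` turns it into `ε^(4m - 2)`.
    -- Here `192 = 8 · 12 · 2`, with the stray factor `m` absorbed by `m ≤ 2^m`.
    have key : 8 * (12 * m ^ 2) ^ m * (n * σ)
        = (8 * 12 ^ m * m) * ((m / n) ^ (2 * m - 1)) * (σ * ((n : ℝ) ^ 2) ^ m) := by
      rw [Real.rpow_sub_one (by positivity), Real.rpow_mul (by positivity), Real.rpow_two,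
        div_pow, Real.div_rpow (by positivity) (by positivity),
        Real.mul_rpow (by positivity) (by positivity)]
      field_simp
    have h3 : 8 * 12 ^ m * m ≤ (192 : ℝ) ^ (2 * m - 1) := by
      have e1 : (12 : ℝ) ^ m ≤ 12 ^ (2 * m - 1) :=
        Real.rpow_le_rpow_of_exponent_le (by norm_num) (by linarith)
      have e2 : (2 : ℝ) ^ m ≤ 2 ^ (2 * m - 1) :=
        Real.rpow_le_rpow_of_exponent_le (by norm_num) (by linarith)
      have e3 : (8 : ℝ) ≤ 8 ^ (2 * m - 1) :=
        h8.trans (Real.rpow_le_rpow_of_exponent_le (by norm_num) (by linarith))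
      calc 8 * 12 ^ m * m ≤ 8 ^ (2 * m - 1) * 12 ^ (2 * m - 1) * 2 ^ (2 * m - 1) := by
            gcongr
            exact hm2.trans e2
        _ = _ := by
            rw [← Real.mul_rpow (by norm_num) (by norm_num),
              ← Real.mul_rpow (by norm_num) (by norm_num)]
            norm_num
    rw [key]
    calc (8 * 12 ^ m * m) * ((m / n) ^ (2 * m - 1)) * (σ * ((n : ℝ) ^ 2) ^ m)
        ≤ (192 : ℝ) ^ (2 * m - 1) * ((m / n) ^ (2 * m - 1)) * (σ * ((n : ℝ) ^ 2) ^ m) := by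
          gcongr
      _ = (192 * (m / n)) ^ (2 * m - 1) * (σ * ((n : ℝ) ^ 2) ^ m) := by
          rw [Real.mul_rpow (by norm_num) (by positivity)]
      _ ≤ (ε ^ 2) ^ (2 * m - 1) * (σ * ((n : ℝ) ^ 2) ^ m) := by
          gcongr
          linarith
      _ = ε ^ (4 * m - 2) * σ * ((n : ℝ) ^ 2) ^ m := by
          rw [← Real.rpow_two, ← Real.rpow_mul hε.le]
          ring_nf

end moments

/-! ### Random sampling and pigeonholing of translates. -/

section sampling

variable {G : Type*}

theorem indFun_of_mem {X : Finset G} {x : G} (h : x ∈ X) : indFun X x = 1 := by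
  simp [indFun, h]

theorem indFun_of_notMem {X : Finset G} {x : G} (h : x ∉ X) : indFun X x = 0 := by
  simp [indFun, h]

theorem indFun_nonneg (X : Finset G) (x : G) : 0 ≤ indFun X x := by
  by_cases h : x ∈ X <;> simp [indFun_of_mem, indFun_of_notMem, h]

theorem indFun_le_one (X : Finset G) (x : G) : indFun X x ≤ 1 := by
  by_cases h : x ∈ X <;> simp [indFun_of_mem, indFun_of_notMem, h]

theorem indFun_sq (X : Finset G) (x : G) : indFun X x ^ 2 = indFun X x := by
  by_cases h : x ∈ X <;> simp [indFun_of_mem, indFun_of_notMem, h]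

theorem sum_indFun_mul [Fintype G] (X : Finset G) (u : G → ℝ) :
    ∑ x, indFun X x * u x = ∑ x ∈ X, u x := by
  classical
  rw [← Finset.sum_subset (Finset.subset_univ X)]
  · exact Finset.sum_congr rfl fun x hx => by rw [indFun_of_mem hx, one_mul]
  · intro x _ hx
    rw [indFun_of_notMem hx, zero_mul]

variable [AddCommGroup G] [Fintype G]

theorem conv_muFun_left (A : Finset G) (u : G → ℝ) (x : G) :
    conv (muFun A) u x = (∑ y ∈ A, u (x - y)) / A.card := by
  unfold conv muFun
  rw [← sum_indFun_mul A, Finset.sum_div]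
  exact Finset.sum_congr rfl fun y _ => by ring

theorem conv_muFun_right (A : Finset G) (u : G → ℝ) (x : G) :
    conv u (muFun A) x = (∑ y ∈ A, u (x - y)) / A.card := by
  rw [← conv_muFun_left]
  unfold conv
  refine Fintype.sum_equiv (Equiv.subLeft x) _ _ fun y => ?_
  simp [mul_comm]

theorem conv_muFun_nonneg (A : Finset G) {u : G → ℝ} (hu : ∀ x, 0 ≤ u x) (x : G) :
    0 ≤ conv (muFun A) u x := by
  rw [conv_muFun_left]
  exact div_nonneg (Finset.sum_nonneg fun _ _ => hu _) (Nat.cast_nonneg _)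

theorem conv_muFun_le_one (A : Finset G) {u : G → ℝ} (hu : ∀ x, u x ≤ 1) (x : G) :
    conv (muFun A) u x ≤ 1 := by
  rw [conv_muFun_left]
  refine div_le_one_of_le₀ ?_ (Nat.cast_nonneg _)
  refine (Finset.sum_le_sum fun y _ => hu (x - y)).trans ?_
  simp

/-- The variance of `1_L (x - a)` for a random element `a` of `A`. -/
theorem sum_sq_indFun_sub {A : Finset G} (hA : A.Nonempty) (L : Finset G) (x : G) :
    ∑ a ∈ A, (indFun L (x - a) - conv (muFun A) (indFun L) x) ^ 2
      = A.card * (conv (muFun A) (indFun L) x * (1 - conv (muFun A) (indFun L) x)) := by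
  have hc : (A.card : ℝ) ≠ 0 := by exact_mod_cast hA.card_pos.ne'
  set g := conv (muFun A) (indFun L) x with hg
  have h1 : ∑ a ∈ A, indFun L (x - a) = A.card * g := by
    rw [hg, conv_muFun_left]; field_simp
  have h2 : ∀ a, (indFun L (x - a) - g) ^ 2 = (1 - 2 * g) * indFun L (x - a) + g ^ 2 := by
    intro a
    have := indFun_sq L (x - a)
    linear_combination this
  simp only [h2]
  rw [Finset.sum_add_distrib, ← Finset.mul_sum, h1]
  simp
  ring

/-- Markov's inequality; the non-strict threshold keeps it valid when `Z = 0`. -/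
theorem card_filter_le_two_mul {ι : Type*} (s : Finset ι) (h : ι → ℝ) (h0 : ∀ i ∈ s, 0 ≤ h i)
    {Z : ℝ} (hZ : ∑ i ∈ s, h i ≤ s.card * Z) :
    s.card ≤ 2 * (s.filter fun i => h i ≤ 2 * Z).card := by
  classical
  by_contra! hlt
  have hsplit := Finset.card_filter_add_card_filter_not (s := s) (fun i => h i ≤ 2 * Z)
  have hbad : s.card < 2 * (s.filter fun i => ¬ h i ≤ 2 * Z).card := by omega
  have hne : (s.filter fun i => ¬ h i ≤ 2 * Z).Nonempty := by
    rw [← Finset.card_pos]; omega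
  have h1 : ∑ i ∈ s.filter (fun i => ¬ h i ≤ 2 * Z), 2 * Z
      < ∑ i ∈ s.filter (fun i => ¬ h i ≤ 2 * Z), h i :=
    Finset.sum_lt_sum_of_nonempty hne fun i hi => not_le.mp (Finset.mem_filter.mp hi).2
  have h2 : ∑ i ∈ s.filter (fun i => ¬ h i ≤ 2 * Z), h i ≤ ∑ i ∈ s, h i :=
    Finset.sum_le_sum_of_subset_of_nonneg (Finset.filter_subset _ _) fun i hi _ => h0 i hi
  have hZ0 : 0 ≤ Z := by
    have hs : (0 : ℝ) < s.card := by
      exact_mod_cast lt_of_lt_of_le (Finset.card_pos.mpr hne) (Finset.card_filter_le _ _)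
    have := (Finset.sum_nonneg h0).trans hZ
    exact nonneg_of_mul_nonneg_right this hs
  rw [Finset.sum_const, nsmul_eq_mul] at h1
  have h3 : (s.card : ℝ) ≤ 2 * (s.filter fun i => ¬ h i ≤ 2 * Z).card := by exact_mod_cast hbad.le
  nlinarith

/-- If most tuples of elements of `A` are good and `A + S` is small, then some tuple has many
translates by elements of `S` that are good. -/
theorem exists_translates_mem [DecidableEq G] {A S : Finset G} {K : ℝ}
    (hA : A.Nonempty) (hS : S.Nonempty) (hK : ((A + S).card : ℝ) ≤ K * A.card) {n : ℕ}
    (P : Finset (Fin n → G)) (hPA : P ⊆ Fintype.piFinset fun _ => A)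
    (hP : (Fintype.piFinset fun _ : Fin n => A).card ≤ 2 * P.card) :
    ∃ b : Fin n → G, (S.card : ℝ) ≤ 2 * K ^ n * (S.filter fun s => (fun i => b i - s) ∈ P).card := by
  set Ω := Fintype.piFinset fun _ : Fin n => A + S with hΩ
  have hc : (0 : ℝ) < A.card := by exact_mod_cast hA.card_pos
  have hΩne : Ω.Nonempty := by
    rw [hΩ, Fintype.piFinset_nonempty]
    exact fun _ => hA.add hS
  -- Double counting of pairs `(b, s)` with `b - s ∈ P`. For fixed `s ∈ S` every element of `P`
  -- occurs exactly once, since `P ⊆ A^n` gives `P + s ⊆ (A + S)^n`.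
  have hcount : ∑ b ∈ Ω, (S.filter fun s => (fun i => b i - s) ∈ P).card = S.card * P.card := by
    have h1 : ∀ s ∈ S, (Ω.filter fun b => (fun i => b i - s) ∈ P).card = P.card := by
      intro s hs
      refine Finset.card_bij (fun b _ => fun i => b i - s)
        (fun b hb => (Finset.mem_filter.mp hb).2) ?_ ?_
      · intro b _ b' _ h
        funext i
        simpa using congrFun h i
      · intro a ha
        refine ⟨fun i => a i + s, ?_, by simp⟩
        rw [Finset.mem_filter]
        refine ⟨?_, by simpa using ha⟩
        rw [hΩ, Fintype.mem_piFinset]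
        exact fun i => Finset.add_mem_add (Fintype.mem_piFinset.mp (hPA ha) i) hs
    calc ∑ b ∈ Ω, (S.filter fun s => (fun i => b i - s) ∈ P).card
        = ∑ s ∈ S, (Ω.filter fun b => (fun i => b i - s) ∈ P).card := by
          simp only [Finset.card_filter]
          exact Finset.sum_comm
      _ = S.card * P.card := by rw [Finset.sum_congr rfl h1]; simp
  by_contra! hlt
  have h2 : ∑ b ∈ Ω, 2 * K ^ n * ((S.filter fun s => (fun i => b i - s) ∈ P).card : ℝ)
      < ∑ b ∈ Ω, (S.card : ℝ) := Finset.sum_lt_sum_of_nonempty hΩne fun b _ => hlt b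
  rw [← Finset.mul_sum, ← Nat.cast_sum, hcount, Finset.sum_const, nsmul_eq_mul] at h2
  have h3 : (Ω.card : ℝ) ≤ K ^ n * (A.card : ℝ) ^ n := by
    rw [hΩ, Fintype.card_piFinset_const, Nat.cast_pow, ← mul_pow]
    exact pow_le_pow_left₀ (Nat.cast_nonneg _) hK n
  rw [Fintype.card_piFinset_const] at hP
  have h4 : (A.card : ℝ) ^ n ≤ 2 * P.card := by exact_mod_cast hP
  have hK0 : 0 ≤ K := by
    have := (Nat.cast_nonneg _).trans hK
    exact nonneg_of_mul_nonneg_left this hc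
  have h5 : (Ω.card : ℝ) * S.card ≤ K ^ n * (2 * P.card) * S.card := by
    have := mul_le_mul_of_nonneg_left h4 (pow_nonneg hK0 n)
    gcongr
    linarith
  push_cast at h2
  linarith

/-- Taking `2m`-th roots of the Markov bound: the root is subadditive since `1 / (2m) ≤ 1`, and the
leading 2 becomes at most 2. -/
theorem rpow_two_mul_add_le {m ε a b : ℝ} (hm : 1 ≤ m) (hε : 0 < ε) (ha : 0 ≤ a) (hb : 0 ≤ b) :
    (2 * (ε ^ (2 * m) * a + ε ^ (4 * m - 2) * b)) ^ (1 / (2 * m))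
      ≤ 2 * (ε * (a ^ (1 / m)) ^ (1 / 2 : ℝ) + ε ^ (2 - 1 / m) * b ^ (1 / (2 * m))) := by
  have hm0 : 0 < m := by linarith
  have h1 : (1 : ℝ) / (2 * m) ≤ 1 := by rw [div_le_one (by positivity)]; linarith
  rw [Real.mul_rpow (by norm_num) (by positivity)]
  have h2 : (2 : ℝ) ^ (1 / (2 * m)) ≤ 2 := by
    simpa using Real.rpow_le_rpow_of_exponent_le (by norm_num : (1 : ℝ) ≤ 2) h1
  have h3 := Real.rpow_add_le_add_rpow (by positivity : 0 ≤ ε ^ (2 * m) * a)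
    (by positivity : 0 ≤ ε ^ (4 * m - 2) * b) (by positivity : 0 ≤ 1 / (2 * m)) h1
  have h4 : (ε ^ (2 * m) * a) ^ (1 / (2 * m)) = ε * (a ^ (1 / m)) ^ (1 / 2 : ℝ) := by
    rw [Real.mul_rpow (by positivity) ha, ← Real.rpow_mul hε.le, ← Real.rpow_mul ha]
    congr 1
    · rw [mul_one_div_cancel (by positivity), Real.rpow_one]
    · congr 1; field_simp
  have h5 : (ε ^ (4 * m - 2) * b) ^ (1 / (2 * m)) = ε ^ (2 - 1 / m) * b ^ (1 / (2 * m)) := by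
    rw [Real.mul_rpow (by positivity) hb, ← Real.rpow_mul hε.le]
    congr 2
    field_simp
    ring
  rw [h4, h5] at h3
  exact mul_le_mul h2 h3 (by positivity) (by norm_num)

/-- The sampling argument: many translates of one average of `1_L` approximate `μ_A * 1_L`. -/
theorem exists_translates_approx [DecidableEq G] {m ε K : ℝ} {A S : Finset G} (L E : Finset G)
    {n : ℕ} (hm : 1 ≤ m) (hε : 0 < ε) (hA : A.Nonempty) (hS : S.Nonempty)
    (hn : 192 * m ≤ n * ε ^ 2) (hK : ((A + S).card : ℝ) ≤ K * A.card)
    {g f : G → ℝ} (hg : g = conv (muFun A) (indFun L)) (hf : f = fun x => g x * (1 - g x)) :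
    ∃ X ⊆ S, (S.card : ℝ) ≤ 2 * K ^ n * X.card ∧ ∃ F : G → ℝ, ∀ s ∈ X,
      lpSum (2 * m) E (fun x => F (x + s) - g x)
        ≤ 2 * (ε * lpSum m E f ^ (1 / 2 : ℝ) + ε ^ (2 - 1 / m) * lpSum 1 E f ^ (1 / (2 * m))) := by
  have hm0 : 0 < m := by linarith
  have hc : (0 : ℝ) < A.card := by exact_mod_cast hA.card_pos
  have hn0 : (n : ℝ) ≠ 0 := by
    intro h; rw [h] at hn; linarith
  have hg0 : ∀ x, 0 ≤ g x := fun x => by rw [hg]; exact conv_muFun_nonneg _ (indFun_nonneg L) x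
  have hg1 : ∀ x, g x ≤ 1 := fun x => by rw [hg]; exact conv_muFun_le_one _ (indFun_le_one L) x
  have hf0 : ∀ x, 0 ≤ f x := fun x => by
    rw [hf]; exact mul_nonneg (hg0 x) (by linarith [hg1 x])
  let F : (Fin n → G) → G → ℝ := fun b x => (∑ i, indFun L (x - b i)) / n
  let Ω := Fintype.piFinset fun _ : Fin n => A
  let Z : ℝ := ε ^ (2 * m) * ∑ x ∈ E, |f x| ^ m + ε ^ (4 * m - 2) * ∑ x ∈ E, |f x| ^ (1 : ℝ)
  have hmom : ∀ x, ∑ a ∈ Ω, |F a x - g x| ^ (2 * m)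
      ≤ (A.card : ℝ) ^ n * (ε ^ (2 * m) * f x ^ m + ε ^ (4 * m - 2) * f x) := by
    intro x
    have h0 : ∑ a ∈ A, (indFun L (x - a) - g x) = 0 := by
      rw [Finset.sum_sub_distrib, hg, conv_muFun_left]
      simp; field_simp; simp
    have h1 : ∀ a ∈ A, |indFun L (x - a) - g x| ≤ 1 := by
      intro a _
      rw [abs_le]
      constructor <;>
      linarith [indFun_nonneg L (x - a), indFun_le_one L (x - a), hg0 x, hg1 x]
    have h2 : ∑ a ∈ A, (indFun L (x - a) - g x) ^ 2 = A.card * f x := by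
      rw [hf, hg]; exact sum_sq_indFun_sub hA L x
    refine le_trans (le_of_eq ?_)
      (sum_piFinset_average_rpow_le (fun a => indFun L (x - a) - g x) h1 h0 (hf0 x) h2 hm hε hn)
    refine Finset.sum_congr rfl fun a _ => ?_
    congr 2
    simp only [F, Finset.sum_sub_distrib]
    simp only [Finset.sum_const, Finset.card_univ, Fintype.card_fin, nsmul_eq_mul]
    field_simp
  have hZ : ∑ a ∈ Ω, ∑ x ∈ E, |F a x - g x| ^ (2 * m) ≤ Ω.card * Z := by
    rw [Finset.sum_comm]
    refine (Finset.sum_le_sum fun x _ => hmom x).trans (le_of_eq ?_)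
    rw [← Finset.mul_sum, Finset.sum_add_distrib, ← Finset.mul_sum, ← Finset.mul_sum]
    simp only [Ω, Z, Fintype.card_piFinset_const, Nat.cast_pow, abs_of_nonneg (hf0 _),
      Real.rpow_one]
  have hgood := card_filter_le_two_mul Ω _
    (fun a _ => sum_abs_rpow_nonneg (2 * m) E (fun x => F a x - g x)) hZ
  obtain ⟨b, hb⟩ := exists_translates_mem hA hS hK _ (Finset.filter_subset _ _) hgood
  refine ⟨_, Finset.filter_subset _ _, hb, F b, fun s hs => ?_⟩
  have h3 := (Finset.mem_filter.mp (Finset.mem_filter.mp hs).2).2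
  -- Shifting the sample points by `-s` shifts their average by `s`, so one function serves all good
  -- `s`.
  have h4 : ∀ x, F (fun i => b i - s) x = F b (x + s) := by
    intro x
    simp only [F]
    congr 1
    exact Finset.sum_congr rfl fun i _ => by congr 1; abel
  simp only [h4] at h3
  unfold lpSum
  refine (Real.rpow_le_rpow (sum_abs_rpow_nonneg _ _ _) h3 (by positivity)).trans ?_
  rw [one_div_one, Real.rpow_one]
  exact rpow_two_mul_add_le hm hε (sum_abs_rpow_nonneg _ _ _) (sum_abs_rpow_nonneg _ _ _)

end sampling

/-! ### Averaging over differences. -/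

section differenceAverage

variable {G : Type*} [AddCommGroup G]

/-- The average of the translates of `h` by the differences of elements of `X`. -/
noncomputable def diffAverage (X : Finset G) (h : G → ℝ) : G → ℝ :=
  fun x => (∑ q ∈ X ×ˢ X, h (x + (q.1 - q.2))) / ((X ×ˢ X).card : ℝ)

theorem diffAverage_sub (X : Finset G) (h h' : G → ℝ) (x : G) :
    diffAverage X h x - diffAverage X h' x = diffAverage X (fun y => h y - h' y) x := by
  simp only [diffAverage, Finset.sum_sub_distrib, sub_div]

/-- Both `g x` and `g (x + (s - t))` are close to `F (x + s)`: the former through the translate by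
`s` at `x`, the latter through the translate by `t` at `x + (s - t)`. The inclusion hypotheses keep
both points in `B`. -/
theorem lpSum_diff_le {p : ℝ} (hp : 1 ≤ p) {X E₀ B : Finset G} {g F : G → ℝ} {D : ℝ}
    (hF : ∀ s ∈ X, lpSum p B (fun x => F (x + s) - g x) ≤ D) (hE : E₀ ⊆ B)
    (hE' : ∀ x ∈ E₀, ∀ s ∈ X, ∀ t ∈ X, x + (s - t) ∈ B) {s t : G} (hs : s ∈ X) (ht : t ∈ X) :
    lpSum p E₀ (fun x => g (x + (s - t)) - g x) ≤ 2 * D := by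
  have h0 : (0 : ℝ) ≤ p := by linarith
  have h1 : lpSum p E₀ (fun x => F (x + s) - g (x + (s - t))) ≤ D := by
    refine le_trans ?_ (hF t ht)
    have := lpSum_comp_le h0 (X := E₀) (Y := B) (fun x => x + (s - t)) (add_left_injective _)
      (fun x hx => hE' x hx s hs t ht) (fun x => F (x + t) - g x)
    refine le_trans (le_of_eq (lpSum_congr fun x _ => ?_)) this
    congr 3
    abel
  have h2 : lpSum p E₀ (fun x => F (x + s) - g x) ≤ D := (lpSum_mono h0 hE _).trans (hF s hs)
  have h3 := lpSum_add_le hp E₀ (fun x => -(F (x + s) - g (x + (s - t))))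
    (fun x => F (x + s) - g x)
  have h4 : lpSum p E₀ (fun x => -(F (x + s) - g (x + (s - t))))
      = lpSum p E₀ (fun x => F (x + s) - g (x + (s - t))) := lpSum_congr fun x _ => abs_neg _
  have h5 : (fun x => -(F (x + s) - g (x + (s - t))) + (F (x + s) - g x))
      = fun x => g (x + (s - t)) - g x := by funext x; ring
  rw [h5, h4] at h3
  linarith

/-- Telescoping: each new average contributes one error `D`, since averaging does not increase the
norm. The domain must shrink at each step because averaging looks at points moved by `X - X`. -/
theorem lpSum_diffAverage_iterate_sub_le {p : ℝ} (hp : 1 ≤ p) {X : Finset G} (hX : X.Nonempty)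
    {g : G → ℝ} {D : ℝ} (E : ℕ → Finset G) (hE0 : ∀ j, E j ⊆ E 0) {k : ℕ}
    (hE : ∀ j < k, ∀ x ∈ E (j + 1), ∀ s ∈ X, ∀ t ∈ X, x + (s - t) ∈ E j)
    (hD : ∀ s ∈ X, ∀ t ∈ X, lpSum p (E 0) (fun x => g (x + (s - t)) - g x) ≤ D) :
    lpSum p (E k) (fun x => (diffAverage X)^[k] g x - g x) ≤ k * D := by
  have h0 : (0 : ℝ) ≤ p := by linarith
  have hXX : (X ×ˢ X).Nonempty := hX.product hX
  have hone : lpSum p (E 0) (fun x => diffAverage X g x - g x) ≤ D := by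
    have h1 := lpSum_average_le hp (E 0) hXX (fun q x => g (x + (q.1 - q.2)) - g x)
      (fun q hq => hD _ (Finset.mem_product.mp hq).1 _ (Finset.mem_product.mp hq).2)
    refine le_trans (le_of_eq (lpSum_congr fun x _ => ?_)) h1
    have hc : ((X ×ˢ X).card : ℝ) ≠ 0 := by exact_mod_cast hXX.card_pos.ne'
    rw [Finset.sum_sub_distrib, sub_div, Finset.sum_const, nsmul_eq_mul, mul_div_cancel_left₀ _ hc]
    rfl
  induction k with
  | zero => simp [lpSum_zero (by linarith : 0 < p)]
  | succ k ih =>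
    replace ih := ih fun j hj => hE j (hj.trans k.lt_succ_self)
    have h2 : lpSum p (E (k + 1))
        (fun x => diffAverage X (fun y => (diffAverage X)^[k] g y - g y) x) ≤ k * D := by
      refine lpSum_average_le hp (E (k + 1)) hXX
        (fun q x => (diffAverage X)^[k] g (x + (q.1 - q.2)) - g (x + (q.1 - q.2))) fun q hq => ?_
      refine (lpSum_comp_le h0 (fun x => x + (q.1 - q.2)) (add_left_injective _)
        (fun x hx => hE k k.lt_succ_self x hx _ (Finset.mem_product.mp hq).1 _ (Finset.mem_product.mp hq).2)
        (fun x => (diffAverage X)^[k] g x - g x)).trans ih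
    have h3 := (lpSum_mono h0 (hE0 (k + 1)) (fun x => diffAverage X g x - g x)).trans hone
    have h4 := lpSum_add_le hp (E (k + 1))
      (fun x => diffAverage X (fun y => (diffAverage X)^[k] g y - g y) x)
      (fun x => diffAverage X g x - g x)
    have h5 : (fun x => diffAverage X (fun y => (diffAverage X)^[k] g y - g y) x
        + (diffAverage X g x - g x)) = fun x => (diffAverage X)^[k + 1] g x - g x := by
      funext x
      rw [← diffAverage_sub, Function.iterate_succ_apply']
      ring
    rw [h5] at h4
    push_cast
    linarith

end differenceAverage

/-! ### Fourier expansion and damping off the large spectrum. -/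

section fourier

theorem sum_muFun_sq {G : Type*} [Fintype G] {A : Finset G} (hA : A.Nonempty) : ∑ x, muFun A x ^ 2 = 1 / A.card := by
  have hc : (A.card : ℝ) ≠ 0 := by exact_mod_cast hA.card_pos.ne'
  have h1 : ∀ x, muFun A x ^ 2 = indFun A x * (1 / (A.card : ℝ) ^ 2) := by
    intro x
    rw [muFun, div_pow, indFun_sq]
    ring
  simp only [h1]
  rw [sum_indFun_mul]
  simp
  field_simp

theorem sum_indFun_sq {G : Type*} [Fintype G] (L : Finset G) : ∑ x, indFun L x ^ 2 = L.card := by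
  have h1 : ∀ x, indFun L x ^ 2 = indFun L x * 1 := by intro x; rw [indFun_sq, mul_one]
  simp only [h1]
  rw [sum_indFun_mul]
  simp

variable {G : Type*} [AddCommGroup G] [Fintype G]

/-- The Fourier coefficient `∑ x, u x * γ (-x)`. -/
noncomputable def fourierCoeffSum (u : G → ℝ) (γ : AddChar G ℂ) : ℂ := ∑ x, (u x : ℂ) * γ (-x)

theorem sum_addChar_sub [DecidableEq G] (x y : G) :
    ∑ γ : AddChar G ℂ, γ (x - y) = if y = x then (Fintype.card G : ℂ) else 0 := by
  rw [AddChar.sum_apply_eq_ite]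
  simp [sub_eq_zero, eq_comm]

/-- Parseval: expand the square and use orthogonality of characters. -/
theorem sum_norm_sq_fourierCoeffSum (u : G → ℝ) :
    ∑ γ, ‖fourierCoeffSum u γ‖ ^ 2 = Fintype.card G * ∑ x, u x ^ 2 := by
  classical
  have h1 : ∀ γ : AddChar G ℂ, ((‖fourierCoeffSum u γ‖ ^ 2 : ℝ) : ℂ)
      = ∑ x, ∑ y, ((u x : ℂ) * u y) * γ (y - x) := by
    intro γ
    rw [Complex.ofReal_pow, ← Complex.mul_conj', fourierCoeffSum, map_sum, Finset.sum_mul_sum]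
    refine Finset.sum_congr rfl fun x _ => Finset.sum_congr rfl fun y _ => ?_
    rw [map_mul, Complex.conj_ofReal, ← AddChar.map_neg_eq_conj, neg_neg, sub_eq_add_neg,
      AddChar.map_add_eq_mul]
    ring
  have h2 : ((∑ γ, ‖fourierCoeffSum u γ‖ ^ 2 : ℝ) : ℂ)
      = ((Fintype.card G * ∑ x, u x ^ 2 : ℝ) : ℂ) := by
    rw [Complex.ofReal_sum]
    simp only [h1]
    rw [Finset.sum_comm]
    have h3 : ∀ x : G, ∑ γ : AddChar G ℂ, ∑ y, ((u x : ℂ) * u y) * γ (y - x)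
        = Fintype.card G * (u x : ℂ) ^ 2 := by
      intro x
      rw [Finset.sum_comm]
      simp only [← Finset.mul_sum, sum_addChar_sub]
      simp
      ring
    simp only [h3]
    push_cast
    rw [Finset.mul_sum]
  exact_mod_cast h2

/-- A convolution has an absolutely convergent Fourier expansion, with an explicit bound. -/
theorem exists_conv_eq_sum_addChar (u v : G → ℝ) :
    ∃ a : AddChar G ℂ → ℂ, (∀ x, (conv u v x : ℂ) = ∑ γ, a γ * γ x) ∧
      ∑ γ, ‖a γ‖ ≤ Real.sqrt (∑ x, u x ^ 2) * Real.sqrt (∑ x, v x ^ 2) := by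
  classical
  have hN : (0 : ℝ) < Fintype.card G := by exact_mod_cast Fintype.card_pos
  have hNC : (Fintype.card G : ℂ) ≠ 0 := by exact_mod_cast hN.ne'
  refine ⟨fun γ => fourierCoeffSum u γ * fourierCoeffSum v γ / Fintype.card G, fun x => ?_, ?_⟩
  · have h1 : ∀ γ : AddChar G ℂ, fourierCoeffSum u γ * fourierCoeffSum v γ / Fintype.card G * γ x
        = ∑ y, ∑ z, ((u y : ℂ) * v z / Fintype.card G) * γ (x - y - z) := by
      intro γ
      rw [fourierCoeffSum, fourierCoeffSum, Finset.sum_mul_sum, Finset.sum_div, Finset.sum_mul]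
      refine Finset.sum_congr rfl fun y _ => ?_
      rw [Finset.sum_div, Finset.sum_mul]
      refine Finset.sum_congr rfl fun z _ => ?_
      rw [sub_eq_add_neg, sub_eq_add_neg, AddChar.map_add_eq_mul, AddChar.map_add_eq_mul]
      ring
    simp only [h1]
    rw [Finset.sum_comm]
    have h2 : ∀ y : G, ∑ γ : AddChar G ℂ, ∑ z, ((u y : ℂ) * v z / Fintype.card G) * γ (x - y - z)
        = (u y : ℂ) * v (x - y) := by
      intro y
      rw [Finset.sum_comm]
      simp only [← Finset.mul_sum, sum_addChar_sub]
      simp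
    simp only [h2, conv]
    push_cast
    rfl
  · have h1 : ∀ γ : AddChar G ℂ, ‖fourierCoeffSum u γ * fourierCoeffSum v γ / Fintype.card G‖
        = ‖fourierCoeffSum u γ‖ * ‖fourierCoeffSum v γ‖ / Fintype.card G := by
      intro γ; rw [norm_div, norm_mul]; simp
    simp only [h1]
    rw [← Finset.sum_div, div_le_iff₀ hN]
    refine (Real.sum_mul_le_sqrt_mul_sqrt _ _ _).trans (le_of_eq ?_)
    rw [sum_norm_sq_fourierCoeffSum, sum_norm_sq_fourierCoeffSum, Real.sqrt_mul hN.le,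
      Real.sqrt_mul hN.le]
    have := Real.mul_self_sqrt hN.le
    linear_combination Real.sqrt (∑ x, u x ^ 2) * Real.sqrt (∑ x, v x ^ 2) * this

/-- The normalised Fourier coefficient of the indicator function of `X`. -/
noncomputable def muHat (X : Finset G) (γ : AddChar G ℂ) : ℂ := (∑ x ∈ X, γ x) / X.card

theorem norm_muHat_le_one (X : Finset G) (γ : AddChar G ℂ) : ‖muHat X γ‖ ≤ 1 := by
  rw [muHat, norm_div, Complex.norm_natCast]
  refine div_le_one_of_le₀ ((norm_sum_le _ _).trans ?_) (Nat.cast_nonneg _)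
  simp [AddChar.norm_apply]

theorem sum_addChar_diff (X : Finset G) (γ : AddChar G ℂ) :
    (∑ q ∈ X ×ˢ X, γ (q.1 - q.2)) / ((X ×ˢ X).card : ℂ) = ((‖muHat X γ‖ ^ 2 : ℝ) : ℂ) := by
  rw [Complex.ofReal_pow, ← Complex.mul_conj', muHat, map_div₀, map_sum, Complex.conj_natCast,
    div_mul_div_comm, Finset.sum_mul_sum, Finset.sum_product, Finset.card_product, Nat.cast_mul]
  congr 1
  refine Finset.sum_congr rfl fun x _ => Finset.sum_congr rfl fun y _ => ?_
  rw [← AddChar.map_neg_eq_conj, sub_eq_add_neg, AddChar.map_add_eq_mul]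

/-- Translation invariance makes `diffAverage X` diagonal in the characters; `sum_addChar_diff`
computes its multiplier. -/
theorem diffAverage_iterate_eq_sum (X : Finset G) {g : G → ℝ} {a : AddChar G ℂ → ℂ}
    (hg : ∀ x, (g x : ℂ) = ∑ γ, a γ * γ x) (k : ℕ) (x : G) :
    (((diffAverage X)^[k] g x : ℝ) : ℂ) = ∑ γ, a γ * ((‖muHat X γ‖ ^ 2 : ℝ) : ℂ) ^ k * γ x := by
  induction k generalizing x with
  | zero => simpa using hg x
  | succ k ih =>
    rw [Function.iterate_succ_apply', diffAverage]
    push_cast [ih]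
    rw [Finset.sum_comm, Finset.sum_div]
    refine Finset.sum_congr rfl fun γ _ => ?_
    have h1 := sum_addChar_diff X γ
    push_cast at h1
    simp only [AddChar.map_add_eq_mul]
    rw [← Finset.mul_sum, ← Finset.mul_sum, pow_succ _ k, ← h1]
    ring

/-- Almost-periodicity of an iterated difference average at elements that almost annihilate the
large spectrum of `X`. -/
theorem abs_diffAverage_iterate_sub_le (X : Finset G) {g : G → ℝ} {a : AddChar G ℂ → ℂ} {M κ : ℝ}
    (hg : ∀ x, (g x : ℂ) = ∑ γ, a γ * γ x) (ha : ∑ γ, ‖a γ‖ ≤ M) {t : G} (hκ : 0 ≤ κ)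
    (ht : ∀ γ : AddChar G ℂ, 1 / 2 ≤ ‖muHat X γ‖ → ‖γ t - 1‖ ≤ κ) (k : ℕ) (x : G) :
    |(diffAverage X)^[k] g (x + t) - (diffAverage X)^[k] g x| ≤ M * (κ + 2 * (1 / 4) ^ k) := by
  rw [← Real.norm_eq_abs, ← Complex.norm_real, Complex.ofReal_sub,
    diffAverage_iterate_eq_sum X hg, diffAverage_iterate_eq_sum X hg, ← Finset.sum_sub_distrib]
  refine (norm_sum_le _ _).trans ?_
  have h1 : ∀ γ : AddChar G ℂ, ‖a γ * ((‖muHat X γ‖ ^ 2 : ℝ) : ℂ) ^ k * γ (x + t)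
      - a γ * ((‖muHat X γ‖ ^ 2 : ℝ) : ℂ) ^ k * γ x‖ ≤ ‖a γ‖ * (κ + 2 * (1 / 4) ^ k) := by
    intro γ
    have h2 : a γ * ((‖muHat X γ‖ ^ 2 : ℝ) : ℂ) ^ k * γ (x + t)
        - a γ * ((‖muHat X γ‖ ^ 2 : ℝ) : ℂ) ^ k * γ x
        = a γ * (((‖muHat X γ‖ ^ 2 : ℝ) : ℂ) ^ k * (γ t - 1)) * γ x := by
      rw [AddChar.map_add_eq_mul]; ring
    rw [h2, norm_mul, norm_mul, AddChar.norm_apply, mul_one]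
    refine mul_le_mul_of_nonneg_left ?_ (norm_nonneg _)
    rw [norm_mul, norm_pow, Complex.norm_real, Real.norm_of_nonneg (by positivity)]
    have h4 : 0 ≤ (1 / 4 : ℝ) ^ k := by positivity
    -- On the large spectrum `t` almost annihilates `γ`; elsewhere each averaging gains a factor
    -- `1/4` and `‖γ t - 1‖ ≤ 2` suffices.
    rcases le_total (1 / 2) ‖muHat X γ‖ with h | h
    · have h3 : (‖muHat X γ‖ ^ 2) ^ k ≤ 1 :=
        pow_le_one₀ (by positivity) (pow_le_one₀ (norm_nonneg _) (norm_muHat_le_one X γ))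
      have := mul_le_mul h3 (ht γ h) (norm_nonneg _) zero_le_one
      linarith
    · have h3 : (‖muHat X γ‖ ^ 2) ^ k ≤ (1 / 4) ^ k := by
        refine pow_le_pow_left₀ (by positivity) ?_ k
        nlinarith [norm_nonneg (muHat X γ)]
      have h5 : ‖γ t - 1‖ ≤ 2 := by
        refine (norm_sub_le _ _).trans ?_
        rw [AddChar.norm_apply, norm_one]; norm_num
      have := mul_le_mul h3 h5 (norm_nonneg _) h4
      linarith
  refine (Finset.sum_le_sum fun γ _ => h1 γ).trans ?_
  rw [← Finset.sum_mul]
  exact mul_le_mul_of_nonneg_right ha (by positivity)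

end fourier

/-! ### A covering lemma for monotone functions. -/

section monotone

/-- Remove the interval with the greatest right endpoint: by disjointness all the others end before
it begins, so its left endpoint becomes the new upper bound. -/
theorem sum_sub_le_of_disjoint_Icc {F : ℝ → ℝ} (hF : Monotone F) {ι : Type*} (I : Finset ι)
    (c d : ι → ℝ) (hcd : ∀ i ∈ I, c i ≤ d i)
    (hI : (I : Set ι).PairwiseDisjoint fun i => Set.Icc (c i) (d i)) {a b : ℝ} (hab : a ≤ b)
    (ha : ∀ i ∈ I, a ≤ c i) (hb : ∀ i ∈ I, d i ≤ b) :
    ∑ i ∈ I, (F (d i) - F (c i)) ≤ F b - F a := by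
  classical
  induction I using Finset.induction_on_max_value d generalizing b with
  | empty => simpa using hF hab
  | insert i I hi hmax ih =>
    rw [Finset.sum_insert hi]
    have hlt : ∀ j ∈ I, d j ≤ c i := by
      intro j hj
      by_contra! h
      have hne : j ≠ i := fun h => hi (h ▸ hj)
      have hdis := hI (Finset.mem_coe.mpr (Finset.mem_insert_of_mem hj))
        (Finset.mem_coe.mpr (Finset.mem_insert_self i I)) hne
      exact Set.disjoint_left.mp hdis
        (Set.right_mem_Icc.mpr (hcd j (Finset.mem_insert_of_mem hj))) ⟨h.le, hmax j hj⟩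
    have h1 := ih (b := c i) (fun j hj => hcd j (Finset.mem_insert_of_mem hj))
      (hI.subset (by simp)) (ha i (Finset.mem_insert_self i I))
      (fun j hj => ha j (Finset.mem_insert_of_mem hj)) hlt
    have h2 := hF (hb i (Finset.mem_insert_self i I))
    linarith

/-- A monotone function of small total increment satisfies a two-sided Lipschitz bound around some
point. -/
theorem exists_abs_sub_le_of_monotone {F : ℝ → ℝ} (hF : Monotone F) {a b h₀ K : ℝ} (hab : a ≤ b)
    (hh : 0 ≤ h₀) (hK : 0 < K) (hinc : 4 * (F (b + h₀) - F (a - h₀)) < K * (b - a)) :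
    ∃ s, a ≤ s ∧ s ≤ b ∧ ∀ h, |h| ≤ h₀ → |F (s + h) - F s| ≤ K * |h| := by
  by_contra! hbad
  have hbad' : ∀ s, ∃ h, s ∈ Set.Icc a b → |h| ≤ h₀ ∧ K * |h| < |F (s + h) - F s| := by
    intro s
    by_cases hs : s ∈ Set.Icc a b
    · obtain ⟨h, h1, h2⟩ := hbad s hs.1 hs.2
      exact ⟨h, fun _ => ⟨h1, h2⟩⟩
    · exact ⟨0, fun h => absurd h hs⟩
  choose h hh' using hbad'
  let x : ℝ → ℝ := fun s => s + h s / 2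
  let r : ℝ → ℝ := fun s => |h s| / 2
  have hpos : ∀ s ∈ Set.Icc a b, 0 < |h s| := by
    intro s hs
    refine abs_pos.mpr fun h0 => ?_
    have := (hh' s hs).2
    simp [h0] at this
  have hend : ∀ s ∈ Set.Icc a b, K * (2 * r s) ≤ F (x s + r s) - F (x s - r s) := by
    intro s hs
    have h1 := (hh' s hs).2.le
    simp only [x, r]
    rcases le_total 0 (h s) with h0 | h0
    · rw [abs_of_nonneg h0] at h1 ⊢
      rw [abs_of_nonneg (sub_nonneg.mpr (hF (by linarith)))] at h1
      have e1 : s + h s / 2 + h s / 2 = s + h s := by ring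
      have e2 : s + h s / 2 - h s / 2 = s := by ring
      rw [e1, e2]; linarith
    · rw [abs_of_nonpos h0] at h1 ⊢
      rw [abs_of_nonpos (sub_nonpos.mpr (hF (by linarith)))] at h1
      have e1 : s + h s / 2 + -h s / 2 = s := by ring
      have e2 : s + h s / 2 - -h s / 2 = s + h s := by ring
      rw [e1, e2]; linarith
  -- If every `s` is bad, the interval between `s` and `s + h s` carries an increment of at least
  -- `K` times its length. Vitali's lemma gives disjoint intervals whose fourfold enlargements cover
  -- `[a, b]`, so the total increment is at least `K (b - a) / 4`. This is the source of the 4 in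
  -- `hinc`.
  obtain ⟨u, hu, hdis, hcov⟩ := Vitali.exists_disjoint_subfamily_covering_enlargement_closedBall
    (Set.Icc a b) x r (h₀ / 2) (fun s hs => by
      have := (hh' s hs).1
      simp only [r]; linarith) 4 (by norm_num)
  have hcount : u.Countable := by
    refine hdis.countable_of_nonempty_interior fun s hs => ?_
    have h1 : 0 < r s := by have := hpos s (hu hs); simp only [r]; linarith
    exact ⟨x s, Metric.ball_subset_interior_closedBall (Metric.mem_ball_self h1)⟩
  have hsub : Set.Icc a b ⊆ ⋃ s ∈ u, Metric.closedBall (x s) (4 * r s) := by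
    intro s hs
    obtain ⟨s', hs', hsub⟩ := hcov s hs
    refine Set.mem_biUnion hs' (hsub ?_)
    rw [Metric.mem_closedBall, Real.dist_eq]
    simp only [x, r]
    rw [show s - (s + h s / 2) = -(h s / 2) by ring, abs_neg, abs_div, abs_two]
  have hfin : ∀ I : Finset u, ∑ s ∈ I, MeasureTheory.volume (Metric.closedBall (x s) (4 * r s))
      ≤ ENNReal.ofReal (4 * (F (b + h₀) - F (a - h₀)) / K) := by
    intro I
    have h1 := sum_sub_le_of_disjoint_Icc hF I (fun s : u => x s - r s) (fun s : u => x s + r s)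
      (fun s hs => by
        have : 0 ≤ r s := by simp only [r]; positivity
        linarith)
      (fun s _ s' _ hne => by
        have := hdis s.2 s'.2 (fun h => hne (Subtype.ext h))
        simpa only [Function.onFun, Real.closedBall_eq_Icc] using this)
      (show a - h₀ ≤ b + h₀ by linarith)
      (fun s _ => by
        have h2 := (hh' s (hu s.2)).1
        have h3 := (hu s.2).1
        simp only [x, r]
        have := neg_abs_le (h s)
        linarith)
      (fun s _ => by
        have h2 := (hh' s (hu s.2)).1
        have h3 := (hu s.2).2
        simp only [x, r]
        have := le_abs_self (h s)
        linarith)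
    have h2 : ∑ s ∈ I, K * (2 * r s) ≤ F (b + h₀) - F (a - h₀) :=
      (Finset.sum_le_sum fun (s : u) _ => hend s.1 (hu s.2)).trans h1
    simp only [Real.volume_closedBall]
    rw [← ENNReal.ofReal_sum_of_nonneg (fun s _ => by simp only [r]; positivity)]
    refine ENNReal.ofReal_le_ofReal ?_
    rw [le_div_iff₀ hK, Finset.sum_mul]
    calc ∑ s ∈ I, 2 * (4 * r s) * K = 4 * ∑ s ∈ I, K * (2 * r s) := by
          rw [Finset.mul_sum]
          exact Finset.sum_congr rfl fun s _ => by ring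
      _ ≤ _ := by linarith
  have hvol : ENNReal.ofReal (b - a) ≤ ENNReal.ofReal (4 * (F (b + h₀) - F (a - h₀)) / K) := by
    rw [← Real.volume_Icc]
    refine (MeasureTheory.measure_mono hsub).trans
      ((MeasureTheory.measure_biUnion_le _ hcount _).trans ?_)
    rw [ENNReal.tsum_eq_iSup_sum]
    exact iSup_le hfin
  have hF0 : 0 ≤ F (b + h₀) - F (a - h₀) := sub_nonneg.mpr (hF (by linarith))
  rw [ENNReal.ofReal_le_ofReal_iff (by positivity), le_div_iff₀ hK] at hvol
  linarith

end monotone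

/-! ### Bohr sets: doubling and existence of regular radii. -/

namespace BohrSet

variable {G : Type*} [AddCommGroup G] [Fintype G]

theorem mem_carrier {B : BohrSet G} {x : G} :
    x ∈ B.carrier ↔ ∀ γ ∈ B.freq, ‖γ x - 1‖ ≤ (B.radius : ℝ) := by
  simp [carrier]

theorem zero_mem_carrier (B : BohrSet G) : (0 : G) ∈ B.carrier := by
  rw [mem_carrier]
  intro γ _
  simp

theorem carrier_nonempty (B : BohrSet G) : B.carrier.Nonempty := ⟨0, B.zero_mem_carrier⟩

theorem card_carrier_pos (B : BohrSet G) : (0 : ℝ) < B.carrier.card := by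
  exact_mod_cast B.carrier_nonempty.card_pos

theorem _root_.AddChar.norm_apply_neg_sub_one (γ : AddChar G ℂ) (x : G) :
    ‖γ (-x) - 1‖ = ‖γ x - 1‖ := by
  rw [AddChar.map_neg_eq_conj, ← Complex.norm_conj (γ x - 1), map_sub, map_one]

theorem _root_.AddChar.norm_apply_add_sub_one_le (γ : AddChar G ℂ) (x y : G) :
    ‖γ (x + y) - 1‖ ≤ ‖γ x - 1‖ + ‖γ y - 1‖ := by
  have h1 : γ (x + y) - 1 = (γ x - 1) * γ y + (γ y - 1) := by
    rw [AddChar.map_add_eq_mul]; ring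
  rw [h1]
  refine (norm_add_le _ _).trans ?_
  rw [norm_mul, AddChar.norm_apply, mul_one]

theorem _root_.AddChar.norm_apply_sub_sub_one (γ : AddChar G ℂ) (x y : G) :
    ‖γ (x - y) - 1‖ = ‖γ x - γ y‖ := by
  have h1 : γ x - γ y = (γ (x - y) - 1) * γ y := by
    rw [sub_mul, ← AddChar.map_add_eq_mul]; simp
  rw [h1, norm_mul, AddChar.norm_apply, mul_one]

theorem neg_mem_carrier {B : BohrSet G} {x : G} (hx : x ∈ B.carrier) : -x ∈ B.carrier := by
  rw [mem_carrier] at hx ⊢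
  intro γ hγ
  rw [AddChar.norm_apply_neg_sub_one]
  exact hx γ hγ

theorem carrier_subset {Γ Λ : Finset (AddChar G ℂ)} {r s : ℝ≥0} (h : Γ ⊆ Λ) (hrs : r ≤ s) :
    (⟨Λ, r⟩ : BohrSet G).carrier ⊆ (⟨Γ, s⟩ : BohrSet G).carrier := by
  intro x hx
  rw [mem_carrier] at hx ⊢
  exact fun γ hγ => (hx γ (h hγ)).trans (by exact_mod_cast hrs)

theorem add_mem_carrier {Γ : Finset (AddChar G ℂ)} {r s t : ℝ≥0} {x y : G}
    (hx : x ∈ (⟨Γ, r⟩ : BohrSet G).carrier) (hy : y ∈ (⟨Γ, s⟩ : BohrSet G).carrier)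
    (h : r + s ≤ t) : x + y ∈ (⟨Γ, t⟩ : BohrSet G).carrier := by
  rw [mem_carrier] at hx hy ⊢
  intro γ hγ
  have h1 : (r : ℝ) + s ≤ t := by exact_mod_cast h
  exact (AddChar.norm_apply_add_sub_one_le γ x y).trans
    ((add_le_add (hx γ hγ) (hy γ hγ)).trans h1)

/-- Near 1 the imaginary part is a good coordinate on the unit circle: both real parts are at least
`1/2`, and factoring the differences of squares in `re² + im² = 1` bounds the real difference by the
imaginary one. -/
theorem _root_.Complex.norm_sub_le_two_mul_abs_im {z w : ℂ} (hz : ‖z‖ = 1) (hw : ‖w‖ = 1)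
    (hz1 : ‖z - 1‖ ≤ 1 / 2) (hw1 : ‖w - 1‖ ≤ 1 / 2) : ‖z - w‖ ≤ 2 * |z.im - w.im| := by
  have hre : ∀ v : ℂ, ‖v - 1‖ ≤ 1 / 2 → 1 / 2 ≤ v.re ∧ |v.im| ≤ 1 / 2 := by
    intro v hv
    have h1 := (Complex.abs_re_le_norm (v - 1)).trans hv
    have h2 := (Complex.abs_im_le_norm (v - 1)).trans hv
    simp only [Complex.sub_re, Complex.one_re, Complex.sub_im, Complex.one_im, sub_zero] at h1 h2
    exact ⟨by linarith [(abs_le.mp h1).1], h2⟩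
  have hsq : ∀ v : ℂ, ‖v‖ = 1 → v.re ^ 2 + v.im ^ 2 = 1 := by
    intro v hv
    have h1 := Complex.sq_norm v
    rw [hv, Complex.normSq_apply] at h1
    linarith
  obtain ⟨a1, a2⟩ := hre z hz1
  obtain ⟨b1, b2⟩ := hre w hw1
  have hz2 := hsq z hz
  have hw2 := hsq w hw
  have h1 : |z.re - w.re| * (z.re + w.re) = |z.im - w.im| * |z.im + w.im| := by
    rw [← abs_of_nonneg (by linarith : 0 ≤ z.re + w.re), ← abs_mul, ← abs_mul, abs_eq_abs]
    right
    linear_combination hz2 - hw2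
  have h2 : |z.im + w.im| ≤ 1 := (abs_add_le _ _).trans (by linarith)
  have h3 : |z.re - w.re| ≤ |z.im - w.im| := by
    have := mul_le_mul_of_nonneg_left h2 (abs_nonneg (z.im - w.im))
    have h4 : |z.re - w.re| * 1 ≤ |z.re - w.re| * (z.re + w.re) :=
      mul_le_mul_of_nonneg_left (by linarith) (abs_nonneg _)
    linarith
  have h5 := Complex.norm_le_abs_re_add_abs_im (z - w)
  rw [Complex.sub_re, Complex.sub_im] at h5
  linarith

/-- Doubling for Bohr sets of small radius. -/
theorem card_carrier_le_pow_mul (Γ : Finset (AddChar G ℂ)) {r s : ℝ≥0} {N : ℕ} (hr : 0 < r)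
    (hr2 : (r : ℝ) ≤ 1 / 2) (hrs : 2 * (r : ℝ) ≤ N * s) :
    (⟨Γ, r⟩ : BohrSet G).carrier.card
      ≤ (⟨Γ, s⟩ : BohrSet G).carrier.card * (2 * N + 1) ^ Γ.card := by
  classical
  have hr' : (0 : ℝ) < r := hr
  have hN : (0 : ℝ) < N := by
    rcases Nat.eq_zero_or_pos N with h | h
    · subst h; norm_num at hrs; linarith
    · exact_mod_cast h
  -- Points are sorted by the imaginary parts of their characters into cells of width `r / N`. Two
  -- points in one cell differ by an element of the smaller Bohr set, because `2r / N ≤ s`.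
  let φ : G → (Γ → ℤ) := fun x γ => ⌊N * (γ.1 x).im / r⌋
  let P : Finset (Γ → ℤ) := Fintype.piFinset fun _ => Finset.Icc (-N : ℤ) N
  have hP : P.card = (2 * N + 1) ^ Γ.card := by
    simp only [P, Fintype.card_piFinset, Int.card_Icc, Finset.prod_const, Finset.card_univ,
      Fintype.card_coe]
    congr 1
    omega
  rw [← hP]
  refine Finset.card_le_mul_card_image_of_maps_to (f := φ) ?_ _ ?_
  · intro x hx
    rw [mem_carrier] at hx
    rw [Fintype.mem_piFinset]
    intro γ
    have h1 : |(γ.1 x).im| ≤ r := by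
      have := (Complex.abs_im_le_norm (γ.1 x - 1)).trans (hx γ.1 γ.2)
      simpa using this
    obtain ⟨h2, h3⟩ := abs_le.mp h1
    rw [Finset.mem_Icc]
    constructor
    · refine Int.le_floor.mpr ?_
      push_cast
      rw [le_div_iff₀ hr']
      nlinarith
    · have : ((⌊N * (γ.1 x).im / r⌋ : ℤ) : ℝ) ≤ N := by
        refine (Int.floor_le _).trans ?_
        rw [div_le_iff₀ hr']
        nlinarith
      exact_mod_cast this
  · intro c _
    rcases Finset.eq_empty_or_nonempty
      (((⟨Γ, r⟩ : BohrSet G).carrier).filter fun x => φ x = c) with h0 | ⟨y, hy⟩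
    · rw [h0]; simp
    · obtain ⟨hy1, hy2⟩ := Finset.mem_filter.mp hy
      refine Finset.card_le_card_of_injOn (fun x => x - y) ?_ (sub_left_injective.injOn)
      intro x hx
      obtain ⟨hx1, hx2⟩ := Finset.mem_filter.mp (Finset.mem_coe.mp hx)
      rw [mem_carrier] at hx1 hy1
      rw [Finset.mem_coe, mem_carrier]
      intro γ hγ
      rw [AddChar.norm_apply_sub_sub_one]
      have hxγ : ‖γ x - 1‖ ≤ r := hx1 γ hγ
      have hyγ : ‖γ y - 1‖ ≤ r := hy1 γ hγ
      refine (Complex.norm_sub_le_two_mul_abs_im (AddChar.norm_apply _ _) (AddChar.norm_apply _ _)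
        (hxγ.trans hr2) (hyγ.trans hr2)).trans ?_
      have h4 : ⌊N * (γ x).im / r⌋ = ⌊N * (γ y).im / r⌋ :=
        congrFun (hx2.trans hy2.symm) ⟨γ, hγ⟩
      have h5 := Int.abs_sub_lt_one_of_floor_eq_floor h4
      have h6 : N * (γ x).im / r - N * (γ y).im / r = N / r * ((γ x).im - (γ y).im) := by ring
      rw [h6, abs_mul, abs_of_pos (by positivity), div_mul_eq_mul_div, div_lt_one hr'] at h5
      have h7 : (N : ℝ) * (2 * |(γ x).im - (γ y).im|) ≤ N * s := by linarith
      exact le_of_mul_le_mul_left h7 hN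

theorem isRegular_of_radius_eq_zero (Γ : Finset (AddChar G ℂ)) :
    (⟨Γ, 0⟩ : BohrSet G).IsRegular := by
  intro τ _
  have h1 : (⟨Γ, 0⟩ : BohrSet G).dilate (1 + τ).toNNReal = ⟨Γ, 0⟩ := by simp [dilate]
  rw [h1, div_self (card_carrier_pos _).ne']
  have : 0 ≤ 12 * ((⟨Γ, 0⟩ : BohrSet G).rank : ℝ) * |τ| := by positivity
  constructor <;> linarith

/-- A Bohr set whose size varies in a Lipschitz manner on the logarithmic scale is regular. -/
theorem isRegular_of_abs_log_sub_le {Γ : Finset (AddChar G ℂ)} (hΓ : Γ.Nonempty) {s : ℝ}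
    (h : ∀ h, |h| ≤ 1 / 10 →
      |Real.log ((⟨Γ, (Real.exp (s + h)).toNNReal⟩ : BohrSet G).carrier.card)
        - Real.log ((⟨Γ, (Real.exp s).toNNReal⟩ : BohrSet G).carrier.card)|
      ≤ 7 * Γ.card * |h|) :
    (⟨Γ, (Real.exp s).toNNReal⟩ : BohrSet G).IsRegular := by
  intro τ hτ
  simp only [rank] at hτ ⊢
  have hd : (1 : ℝ) ≤ Γ.card := by exact_mod_cast hΓ.card_pos
  rw [le_div_iff₀ (by positivity)] at hτ
  have hτ1 : |τ| ≤ 1 / 12 := by nlinarith [abs_nonneg τ]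
  obtain ⟨hτ2, hτ3⟩ := abs_le.mp hτ1
  have hpos : 0 < 1 + τ := by linarith
  have hdil : (⟨Γ, (Real.exp s).toNNReal⟩ : BohrSet G).dilate (1 + τ).toNNReal
      = ⟨Γ, (Real.exp (s + Real.log (1 + τ))).toNNReal⟩ := by
    simp only [dilate]
    congr 1
    rw [Real.exp_add, Real.exp_log hpos, mul_comm, Real.toNNReal_mul (Real.exp_pos _).le]
  rw [hdil]
  set B₀ : BohrSet G := ⟨Γ, (Real.exp s).toNNReal⟩
  set B₁ : BohrSet G := ⟨Γ, (Real.exp (s + Real.log (1 + τ))).toNNReal⟩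
  have h0 := B₀.card_carrier_pos
  have h1 := B₁.card_carrier_pos
  have hratio : (B₁.carrier.card : ℝ) / B₀.carrier.card
      = Real.exp (Real.log B₁.carrier.card - Real.log B₀.carrier.card) := by
    rw [Real.exp_sub, Real.exp_log h1, Real.exp_log h0]
  rw [hratio]
  have hlog1 : Real.log (1 + τ) ≤ τ := by
    have := Real.log_le_sub_one_of_pos hpos; linarith
  have hlog2 : τ / (1 + τ) ≤ Real.log (1 + τ) := by
    have := Real.one_sub_inv_le_log_of_pos hpos
    have e : 1 - (1 + τ)⁻¹ = τ / (1 + τ) := by field_simp; ring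
    linarith
  -- With `u = |Γ||τ| ≤ 1/12`, the slope 7 leaves room below 12: upwards `exp y - 1 ≤ y + y² ≤ 7u +
  -- 49u²`, and downwards `|log (1 + τ)| ≤ (12/11)|τ|` costs only `84u/11`.
  rcases le_total 0 τ with ht | ht
  · have hl0 : 0 ≤ Real.log (1 + τ) := Real.log_nonneg (by linarith)
    have h2 := h (Real.log (1 + τ)) (by rw [abs_of_nonneg hl0]; linarith)
    rw [abs_of_nonneg hl0] at h2
    have hmono : Real.log B₀.carrier.card ≤ Real.log B₁.carrier.card := by
      refine Real.log_le_log h0 ?_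
      exact_mod_cast Finset.card_le_card (carrier_subset subset_rfl
        (Real.toNNReal_le_toNNReal (Real.exp_le_exp.mpr (by linarith))))
    rw [abs_of_nonneg ht] at hτ ⊢
    set y := Real.log B₁.carrier.card - Real.log B₀.carrier.card
    have hy0 : 0 ≤ y := by simp only [y]; linarith
    rw [abs_of_nonneg hy0] at h2
    have hy1 : y ≤ 7 * (Γ.card * τ) := by
      have := mul_le_mul_of_nonneg_left hlog1 (by positivity : (0 : ℝ) ≤ 7 * Γ.card)
      linarith
    have hu0 : 0 ≤ Γ.card * τ := by positivity
    constructor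
    · have := Real.add_one_le_exp y
      linarith
    · have h3 := Real.abs_exp_sub_one_sub_id_le (x := y)
        (by rw [abs_of_nonneg hy0]; linarith)
      have h4 := (abs_le.mp h3).2
      nlinarith
  · have hl0 : Real.log (1 + τ) ≤ 0 := Real.log_nonpos hpos.le (by linarith)
    have hτ4 : 12 / 11 * τ ≤ τ / (1 + τ) := by
      rw [le_div_iff₀ hpos]; nlinarith
    have h2 := h (Real.log (1 + τ)) (by rw [abs_of_nonpos hl0]; linarith)
    rw [abs_of_nonpos hl0] at h2
    have hmono : Real.log B₁.carrier.card ≤ Real.log B₀.carrier.card := by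
      refine Real.log_le_log h1 ?_
      exact_mod_cast Finset.card_le_card (carrier_subset subset_rfl
        (Real.toNNReal_le_toNNReal (Real.exp_le_exp.mpr (by linarith))))
    rw [abs_of_nonpos ht] at hτ ⊢
    set y := Real.log B₁.carrier.card - Real.log B₀.carrier.card
    have hy0 : y ≤ 0 := by simp only [y]; linarith
    rw [abs_of_nonpos hy0] at h2
    have hl : -Real.log (1 + τ) ≤ 12 / 11 * (-τ) := by linarith
    have hy1 := mul_le_mul_of_nonneg_left hl (by positivity : (0 : ℝ) ≤ 7 * Γ.card)
    have hu0 : 0 ≤ Γ.card * (-τ) := by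
      have : 0 ≤ -τ := by linarith
      positivity
    constructor
    · have := Real.add_one_le_exp y
      linarith
    · have : Real.exp y ≤ 1 := Real.exp_le_one_iff.mpr hy0
      linarith

/-- Every small radius is within a constant factor of a regular one. -/
theorem exists_isRegular {Γ : Finset (AddChar G ℂ)} (hΓ : Γ.Nonempty) {R : ℝ≥0}
    (hR : (R : ℝ) ≤ 1 / 4) :
    ∃ R' : ℝ≥0, (R : ℝ) / 81 ≤ R' ∧ R' ≤ R ∧ (⟨Γ, R'⟩ : BohrSet G).IsRegular := by
  rcases eq_or_ne R 0 with h0 | h0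
  · subst h0
    exact ⟨0, by simp, le_rfl, isRegular_of_radius_eq_zero Γ⟩
  have hR0 : (0 : ℝ) < R := by exact_mod_cast pos_iff_ne_zero.mpr h0
  have hd : (1 : ℝ) ≤ Γ.card := by exact_mod_cast hΓ.card_pos
  let F : ℝ → ℝ := fun s =>
    Real.log ((⟨Γ, (Real.exp s).toNNReal⟩ : BohrSet G).carrier.card)
  have hF : Monotone F := by
    intro s t hst
    refine Real.log_le_log (card_carrier_pos _) ?_
    exact_mod_cast Finset.card_le_card (carrier_subset subset_rfl
      (Real.toNNReal_le_toNNReal (Real.exp_le_exp.mpr hst)))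
  have he := Real.exp_one_lt_d9
  have he' := Real.exp_one_gt_d9
  have he0 : 0 ≤ Real.exp 1 := (Real.exp_pos 1).le
  have hpow : ∀ k : ℕ, Real.exp k = Real.exp 1 ^ k := fun k => by
    rw [← Real.exp_nat_mul, mul_one]
  have hexp : ∀ s, (((Real.exp s).toNNReal : ℝ≥0) : ℝ) = Real.exp s := fun s =>
    Real.coe_toNNReal _ (Real.exp_pos _).le
  -- The enlarged window has logarithmic length `4.2`, and `2 exp 4.2 ≤ 300`, so doubling with `N =
  -- 300` bounds the increment by `|Γ| log 601 < 7|Γ|`. The bound `R ≤ 1/4` keeps `R exp (1/10)`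
  -- below `1/2`, where doubling applies.
  have hinc : 4 * (F (Real.log R + 1 / 10) - F (Real.log R - 4 - 1 / 10))
      < 7 * Γ.card * (Real.log R - (Real.log R - 4)) := by
    have h1 : Real.exp (1 / 10 : ℝ) ≤ 2 := by
      have h2 := Real.abs_exp_sub_one_sub_id_le (x := 1 / 10) (by norm_num [abs_of_pos])
      have := (abs_le.mp h2).2
      norm_num at this
      linarith
    have h5 : Real.exp 5 ≤ 150 := by
      have h := hpow 5
      push_cast at h
      rw [h]
      calc Real.exp 1 ^ 5 ≤ 2.7182818286 ^ 5 := pow_le_pow_left₀ he0 he.le 5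
        _ ≤ 150 := by norm_num
    have h2 := card_carrier_le_pow_mul Γ (r := (Real.exp (Real.log R + 1 / 10)).toNNReal)
      (s := (Real.exp (Real.log R - 4 - 1 / 10)).toNNReal) (N := 300)
      (Real.toNNReal_pos.mpr (Real.exp_pos _))
      (by
        rw [hexp, Real.exp_add, Real.exp_log hR0]
        nlinarith [Real.exp_pos (1 / 10 : ℝ)])
      (by
        rw [hexp, hexp]
        have e : Real.log R + 1 / 10 = (Real.log R - 4 - 1 / 10) + 21 / 5 := by ring
        rw [e, Real.exp_add]
        have h6 : Real.exp (21 / 5) ≤ 150 := (Real.exp_le_exp.mpr (by norm_num)).trans h5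
        have h7 := mul_le_mul_of_nonneg_left h6 (Real.exp_pos (Real.log R - 4 - 1 / 10)).le
        push_cast
        linarith)
    have h3 : F (Real.log R + 1 / 10) ≤ F (Real.log R - 4 - 1 / 10) + Γ.card * Real.log 601 := by
      simp only [F]
      rw [← Real.log_pow, ← Real.log_mul (card_carrier_pos _).ne' (by positivity)]
      refine Real.log_le_log (card_carrier_pos _) ?_
      exact_mod_cast h2
    have h4 : Real.log 601 < 7 := by
      rw [Real.log_lt_iff_lt_exp (by norm_num)]
      have h := hpow 7
      push_cast at h
      rw [h]
      calc (601 : ℝ) < 2.7182818283 ^ 7 := by norm_num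
        _ ≤ Real.exp 1 ^ 7 := pow_le_pow_left₀ (by norm_num) he'.le 7
    nlinarith
  obtain ⟨s, hs1, hs2, hs3⟩ := exists_abs_sub_le_of_monotone hF (by linarith) (by norm_num)
    (by positivity) hinc
  refine ⟨(Real.exp s).toNNReal, ?_, ?_, isRegular_of_abs_log_sub_le hΓ hs3⟩
  · rw [hexp]
    have h1 : Real.exp (Real.log R - 4) ≤ Real.exp s := Real.exp_le_exp.mpr hs1
    rw [Real.exp_sub, Real.exp_log hR0] at h1
    refine le_trans ?_ h1
    have h4 : Real.exp 4 ≤ 81 := by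
      have h := hpow 4
      push_cast at h
      rw [h]
      calc Real.exp 1 ^ 4 ≤ 3 ^ 4 := pow_le_pow_left₀ he0 (by linarith) 4
        _ = 81 := by norm_num
    gcongr
  · rw [← NNReal.coe_le_coe, hexp, ← Real.exp_log hR0]
    exact Real.exp_le_exp.mpr hs2

end BohrSet

/-! ### Riesz products. -/

section rieszProduct

variable {G : Type*} [AddCommGroup G] [Fintype G]

/-- The complex form of the factor `1 + a * Re (c * γ x)` of a Riesz product. -/
noncomputable def rieszFactor (a : ℝ) (c : AddChar G ℂ → ℂ) (γ : AddChar G ℂ) (x : G) : ℂ :=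
  1 + a / 2 * (c γ * γ x + (starRingEnd ℂ) (c γ) * γ⁻¹ x)

theorem rieszFactor_eq (a : ℝ) (c : AddChar G ℂ → ℂ) (γ : AddChar G ℂ) (x : G) :
    rieszFactor a c γ x = ((1 + a * (c γ * γ x).re : ℝ) : ℂ) := by
  rw [rieszFactor, AddChar.inv_apply, AddChar.map_neg_eq_conj, ← map_mul, Complex.add_conj]
  push_cast
  ring

theorem sum_mul_rieszFactor_insert [DecidableEq (AddChar G ℂ)] (β : G → ℂ) (a : ℝ)
    (c : AddChar G ℂ → ℂ) {γ : AddChar G ℂ} {Λ : Finset (AddChar G ℂ)} (hγ : γ ∉ Λ)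
    (ψ : AddChar G ℂ) :
    ∑ x, β x * ψ x * ∏ χ ∈ insert γ Λ, rieszFactor a c χ x
      = ∑ x, β x * ψ x * ∏ χ ∈ Λ, rieszFactor a c χ x
        + a / 2 * (c γ * ∑ x, β x * (ψ * γ) x * ∏ χ ∈ Λ, rieszFactor a c χ x
          + (starRingEnd ℂ) (c γ) *
            ∑ x, β x * (ψ * γ⁻¹) x * ∏ χ ∈ Λ, rieszFactor a c χ x) := by
  simp only [Finset.mul_sum, mul_add, ← Finset.sum_add_distrib]
  refine Finset.sum_congr rfl fun x _ => ?_
  rw [Finset.prod_insert hγ, rieszFactor, AddChar.mul_apply, AddChar.mul_apply]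
  ring

omit [Fintype G] in
theorem prod_insert_update [DecidableEq (AddChar G ℂ)] {γ : AddChar G ℂ}
    {Λ : Finset (AddChar G ℂ)} (hγ : γ ∉ Λ) (m : AddChar G ℂ → ℤ) (j : ℤ) :
    ∏ χ ∈ insert γ Λ, χ ^ (Function.update m γ j χ) = γ ^ j * ∏ χ ∈ Λ, χ ^ m χ := by
  rw [Finset.prod_insert hγ, Function.update_self]
  congr 1
  refine Finset.prod_congr rfl fun χ hχ => ?_
  rw [Function.update_of_ne]
  rintro rfl
  exact hγ hχ

omit [Fintype G] in
theorem abs_update_le_one [DecidableEq (AddChar G ℂ)] {m : AddChar G ℂ → ℤ}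
    (hm : ∀ χ, |m χ| ≤ 1) (γ : AddChar G ℂ) {j : ℤ} (hj : |j| ≤ 1) (χ : AddChar G ℂ) :
    |Function.update m γ j χ| ≤ 1 := by
  rcases eq_or_ne χ γ with rfl | h
  · rwa [Function.update_self]
  · rw [Function.update_of_ne h]; exact hm χ

theorem norm_rieszFactor_step {a : ℝ} (ha : 0 ≤ a) {c u v : ℂ} (hc : ‖c‖ ≤ 1) {D : ℝ}
    (hu : ‖u‖ ≤ D) (hv : ‖v‖ ≤ D) : ‖a / 2 * (c * u + (starRingEnd ℂ) c * v)‖ ≤ a * D := by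
  have hD : 0 ≤ D := (norm_nonneg _).trans hu
  rw [norm_mul, norm_div, Complex.norm_real, Real.norm_of_nonneg ha, Complex.norm_two]
  have h1 : ‖c * u + (starRingEnd ℂ) c * v‖ ≤ 1 * D + 1 * D := by
    refine (norm_add_le _ _).trans ?_
    rw [norm_mul, norm_mul, Complex.norm_conj]
    gcongr
  calc a / 2 * ‖c * u + (starRingEnd ℂ) c * v‖ ≤ a / 2 * (1 * D + 1 * D) := by gcongr
    _ = a * D := by ring

/-- Each factor expands into `1`, `γ` and `γ⁻¹` with coefficients of total size at most `1 + a`, so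
the product is a combination of characters of total weight at most `(1 + a)^|Λ|`. -/
theorem norm_sum_mul_rieszProduct_le {β : G → ℂ} {a : ℝ} (ha : 0 ≤ a) {c : AddChar G ℂ → ℂ}
    (hc : ∀ γ, ‖c γ‖ ≤ 1) {κ : ℝ} (Λ : Finset (AddChar G ℂ)) (ψ : AddChar G ℂ)
    (h : ∀ m : AddChar G ℂ → ℤ, (∀ χ, |m χ| ≤ 1) →
      ‖∑ x, β x * (ψ * ∏ χ ∈ Λ, χ ^ m χ) x‖ ≤ κ) :
    ‖∑ x, β x * ψ x * ∏ χ ∈ Λ, rieszFactor a c χ x‖ ≤ κ * (1 + a) ^ Λ.card := by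
  classical
  induction Λ using Finset.induction_on generalizing ψ with
  | empty => simpa using h 0 (by simp)
  | insert γ Λ hγ ih =>
    have hstep : ∀ j : ℤ, |j| ≤ 1 →
        ‖∑ x, β x * (ψ * γ ^ j) x * ∏ χ ∈ Λ, rieszFactor a c χ x‖ ≤ κ * (1 + a) ^ Λ.card := by
      intro j hj
      refine ih _ fun m hm => ?_
      have := h (Function.update m γ j) (abs_update_le_one hm γ hj)
      rwa [prod_insert_update hγ, ← mul_assoc] at this
    rw [sum_mul_rieszFactor_insert β a c hγ, Finset.card_insert_of_notMem hγ]
    have h0 := hstep 0 (by simp)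
    have h1 := hstep 1 (by simp)
    have h2 := hstep (-1) (by simp)
    rw [zpow_zero, mul_one] at h0
    rw [zpow_one] at h1
    rw [zpow_neg_one] at h2
    refine (norm_add_le _ _).trans ?_
    have h3 := norm_rieszFactor_step ha (hc γ) h1 h2
    rw [pow_succ]
    linarith

/-- The subtracted sum is the term of the expansion with all exponents zero; the remaining ones have
total weight at most `(1 + a)^|Λ| - 1`, and only they need a Fourier bound. -/
theorem norm_sum_mul_rieszProduct_sub_le {β : G → ℂ} {a : ℝ} (ha : 0 ≤ a) {c : AddChar G ℂ → ℂ}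
    (hc : ∀ γ, ‖c γ‖ ≤ 1) {κ : ℝ} (Λ : Finset (AddChar G ℂ))
    (h : ∀ m : AddChar G ℂ → ℤ, (∀ χ, |m χ| ≤ 1) → (∃ χ ∈ Λ, m χ ≠ 0) →
      ‖∑ x, β x * (∏ χ ∈ Λ, χ ^ m χ) x‖ ≤ κ) :
    ‖∑ x, β x * ∏ χ ∈ Λ, rieszFactor a c χ x - ∑ x, β x‖ ≤ κ * ((1 + a) ^ Λ.card - 1) := by
  classical
  induction Λ using Finset.induction_on with
  | empty => simp
  | insert γ Λ hγ ih =>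
    have hstep : ∀ j : ℤ, |j| ≤ 1 → j ≠ 0 →
        ‖∑ x, β x * (γ ^ j) x * ∏ χ ∈ Λ, rieszFactor a c χ x‖ ≤ κ * (1 + a) ^ Λ.card := by
      intro j hj hj0
      refine norm_sum_mul_rieszProduct_le ha hc Λ _ fun m hm => ?_
      have := h (Function.update m γ j) (abs_update_le_one hm γ hj)
        ⟨γ, Finset.mem_insert_self _ _, by rwa [Function.update_self]⟩
      rwa [prod_insert_update hγ] at this
    have hih := ih fun m hm hne => by
      obtain ⟨χ, hχ, hχ0⟩ := hne
      have := h (Function.update m γ 0) (abs_update_le_one hm γ (by simp))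
        ⟨χ, Finset.mem_insert_of_mem hχ, by
          rwa [Function.update_of_ne]; rintro rfl; exact hγ hχ⟩
      rwa [prod_insert_update hγ, zpow_zero, one_mul] at this
    have h1 := hstep 1 (by simp) (by simp)
    have h2 := hstep (-1) (by simp) (by simp)
    have hins := sum_mul_rieszFactor_insert β a c hγ 1
    simp only [AddChar.one_apply, mul_one, one_mul] at hins
    rw [zpow_one] at h1
    rw [zpow_neg_one] at h2
    rw [hins, add_sub_right_comm, Finset.card_insert_of_notMem hγ]
    refine (norm_add_le _ _).trans ?_
    have h3 := norm_rieszFactor_step ha (hc γ) h1 h2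
    rw [pow_succ]
    linarith

end rieszProduct

/-! ### Relative dissociativity and spanning. -/

section dissociated

variable {G : Type*} [AddCommGroup G] [Fintype G]

/-- `Λ` is dissociated relative to `V` if no nontrivial `{-1, 0, 1}`-combination of its elements is
in the large spectrum of `V`. -/
def IsDissociatedRel (V : Finset G) (Λ : Finset (AddChar G ℂ)) : Prop :=
  ∀ m : AddChar G ℂ → ℤ, (∀ χ, |m χ| ≤ 1) → (∃ χ ∈ Λ, m χ ≠ 0) →
    ‖muHat V (∏ χ ∈ Λ, χ ^ m χ)‖ ≤ 1 / 2

omit [Fintype G] in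
theorem IsDissociatedRel.subset {V : Finset G} {Λ Λ' : Finset (AddChar G ℂ)}
    (h : IsDissociatedRel V Λ) (hs : Λ' ⊆ Λ) : IsDissociatedRel V Λ' := by
  classical
  intro m hm hne
  obtain ⟨χ, hχ, hχ0⟩ := hne
  have h1 := h (fun χ => if χ ∈ Λ' then m χ else 0)
    (fun χ => by by_cases hc : χ ∈ Λ' <;> simp [hc, hm χ]) ⟨χ, hs hχ, by simpa [hχ] using hχ0⟩
  have h2 : ∏ χ ∈ Λ, χ ^ (if χ ∈ Λ' then m χ else 0) = ∏ χ ∈ Λ', χ ^ m χ := by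
    rw [← Finset.prod_subset hs]
    · exact Finset.prod_congr rfl fun χ hχ => by rw [if_pos hχ]
    · intro χ _ hχ
      rw [if_neg hχ, zpow_zero]
  rwa [h2] at h1

theorem norm_zpow_apply_sub_one {γ : AddChar G ℂ} {j : ℤ} (hj : |j| ≤ 1) (hj0 : j ≠ 0) (t : G) :
    ‖(γ ^ j) t - 1‖ = ‖γ t - 1‖ := by
  have hj' : j = 1 ∨ j = -1 := by rw [abs_le] at hj; omega
  rcases hj' with rfl | rfl
  · rw [zpow_one]
  · rw [zpow_neg_one, AddChar.inv_apply, AddChar.norm_apply_neg_sub_one]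

theorem norm_prod_zpow_apply_sub_one_le {m : AddChar G ℂ → ℤ} (hm : ∀ χ, |m χ| ≤ 1)
    (Λ : Finset (AddChar G ℂ)) (t : G) :
    ‖(∏ χ ∈ Λ, χ ^ m χ) t - 1‖ ≤ ∑ χ ∈ Λ, ‖χ t - 1‖ := by
  classical
  induction Λ using Finset.induction_on with
  | empty => simp
  | insert γ Λ hγ ih =>
    rw [Finset.prod_insert hγ, Finset.sum_insert hγ, AddChar.mul_apply]
    have h1 : ‖(γ ^ m γ) t - 1‖ ≤ ‖γ t - 1‖ := by
      rcases eq_or_ne (m γ) 0 with h | h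
      · rw [h]; simp
      · exact (norm_zpow_apply_sub_one (hm γ) h t).le
    have h2 : (γ ^ m γ) t * (∏ χ ∈ Λ, χ ^ m χ) t - 1
        = ((γ ^ m γ) t - 1) * (∏ χ ∈ Λ, χ ^ m χ) t + ((∏ χ ∈ Λ, χ ^ m χ) t - 1) := by ring
    rw [h2]
    refine (norm_add_le _ _).trans ?_
    rw [norm_mul, AddChar.norm_apply, mul_one]
    linarith

/-- The elements almost annihilating a maximal dissociated subset of `Δ` and the large spectrum of
`V` almost annihilate `Δ`. -/
theorem exists_dissociated_spanning (V : Finset G) (Δ : Finset (AddChar G ℂ)) :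
    ∃ Λ ⊆ Δ, IsDissociatedRel V Λ ∧ ∀ (t : G) (κ₁ κ₂ : ℝ), 0 ≤ κ₁ →
      (∀ χ : AddChar G ℂ, 1 / 2 ≤ ‖muHat V χ‖ → ‖χ t - 1‖ ≤ κ₁) →
      (∑ χ ∈ Λ, ‖χ t - 1‖ ≤ κ₂) → ∀ γ ∈ Δ, ‖γ t - 1‖ ≤ κ₁ + κ₂ := by
  classical
  obtain ⟨Λ, hΛ, hmax⟩ := Finset.exists_max_image
    (Δ.powerset.filter fun Λ => IsDissociatedRel V Λ) Finset.card ⟨∅, by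
      simp [IsDissociatedRel]⟩
  rw [Finset.mem_filter, Finset.mem_powerset] at hΛ
  refine ⟨Λ, hΛ.1, hΛ.2, fun t κ₁ κ₂ hκ₁ h1 h2 γ hγ => ?_⟩
  by_cases hγΛ : γ ∈ Λ
  · have := Finset.single_le_sum (f := fun χ : AddChar G ℂ => ‖χ t - 1‖)
      (fun _ _ => norm_nonneg _) hγΛ
    linarith
  have hnot : ¬ IsDissociatedRel V (insert γ Λ) := by
    intro hd
    have := hmax (insert γ Λ) (by
      rw [Finset.mem_filter, Finset.mem_powerset]
      exact ⟨Finset.insert_subset hγ hΛ.1, hd⟩)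
    rw [Finset.card_insert_of_notMem hγΛ] at this
    omega
  unfold IsDissociatedRel at hnot
  push Not at hnot
  obtain ⟨m, hm, hne, hbig⟩ := hnot
  rw [Finset.prod_insert hγΛ] at hbig
  -- Maximality yields a relation in `insert γ Λ`. It must involve `γ`, or it would contradict
  -- dissociativity of `Λ`; hence `γ^{±1}` is a large-spectrum character times a combination of `Λ`.
  have hmγ : m γ ≠ 0 := by
    intro h0
    rw [h0, zpow_zero, one_mul] at hbig
    refine absurd (hΛ.2 m hm ?_) (not_le.mpr hbig)
    obtain ⟨χ, hχ, hχ0⟩ := hne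
    rcases Finset.mem_insert.mp hχ with rfl | h
    · exact absurd h0 hχ0
    · exact ⟨χ, h, hχ0⟩
  have h3 := h1 _ hbig.le
  have h4 := (norm_prod_zpow_apply_sub_one_le hm Λ t).trans h2
  rw [← norm_zpow_apply_sub_one (hm γ) hmγ]
  rw [AddChar.mul_apply] at h3
  set u := (γ ^ m γ) t
  set v := (∏ χ ∈ Λ, χ ^ m χ) t with hv
  have h5 : u - 1 = (u * v - 1) - u * (v - 1) := by ring
  have hu : ‖u‖ = 1 := AddChar.norm_apply _ _
  rw [h5]
  refine (norm_sub_le _ _).trans ?_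
  rw [norm_mul, hu, one_mul]
  linarith

end dissociated

/-! ### Smoothed majorants with small Fourier coefficients. -/

section majorant

variable {G : Type*} [AddCommGroup G] [Fintype G]

/-- Convolution of `h` with the uniform measure on `V`. -/
noncomputable def smooth (V : Finset G) (h : G → ℝ) : G → ℝ :=
  fun x => (∑ v ∈ V, h (x - v)) / V.card

omit [Fintype G] in
theorem smooth_nonneg (V : Finset G) {h : G → ℝ} (hh : ∀ x, 0 ≤ h x) (x : G) :
    0 ≤ smooth V h x :=
  div_nonneg (Finset.sum_nonneg fun _ _ => hh _) (Nat.cast_nonneg _)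

omit [Fintype G] in
theorem smooth_iterate_nonneg (V : Finset G) {h : G → ℝ} (hh : ∀ x, 0 ≤ h x) (l : ℕ) (x : G) :
    0 ≤ (smooth V)^[l] h x := by
  induction l generalizing x with
  | zero => exact hh x
  | succ l ih => rw [Function.iterate_succ_apply']; exact smooth_nonneg V ih x

theorem sum_smooth_mul_addChar (V : Finset G) (h : G → ℝ) (γ : AddChar G ℂ) :
    ∑ x, (smooth V h x : ℂ) * γ x = muHat V γ * ∑ x, (h x : ℂ) * γ x := by
  simp only [smooth, muHat]
  push_cast
  simp only [div_mul_eq_mul_div]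
  rw [← Finset.sum_div]
  congr 1
  simp only [Finset.sum_mul]
  rw [Finset.sum_comm]
  refine Finset.sum_congr rfl fun v _ => ?_
  rw [Finset.mul_sum, ← Equiv.sum_comp (Equiv.addRight v)]
  refine Finset.sum_congr rfl fun x _ => ?_
  simp only [Equiv.coe_addRight, add_sub_cancel_right, AddChar.map_add_eq_mul]
  ring

theorem sum_smooth_iterate_mul_addChar (V : Finset G) (h : G → ℝ) (γ : AddChar G ℂ) (l : ℕ) :
    ∑ x, (((smooth V)^[l] h x : ℝ) : ℂ) * γ x = muHat V γ ^ l * ∑ x, (h x : ℂ) * γ x := by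
  induction l with
  | zero => simp
  | succ l ih =>
    rw [Function.iterate_succ_apply', sum_smooth_mul_addChar, ih, pow_succ]
    ring

theorem norm_sum_indFun_mul_addChar_le (W : Finset G) (γ : AddChar G ℂ) :
    ‖∑ x, (indFun W x : ℂ) * γ x‖ ≤ W.card := by
  refine (norm_sum_le _ _).trans ?_
  have h1 : ∀ x, ‖(indFun W x : ℂ) * γ x‖ = indFun W x * 1 := by
    intro x
    rw [norm_mul, AddChar.norm_apply, Complex.norm_real, Real.norm_of_nonneg (indFun_nonneg W x)]
  simp only [h1]
  rw [sum_indFun_mul]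
  simp

/-- Each of the `l` smoothings moves a point by at most radius `r`, so starting from radius `s'` the
values seen all lie in the larger Bohr set. -/
theorem BohrSet.smooth_iterate_indFun_eq_one {Γ : Finset (AddChar G ℂ)} {r : ℝ≥0} (l : ℕ)
    {s s' : ℝ≥0} (hs : s' + l * r ≤ s) {x : G} (hx : x ∈ (⟨Γ, s'⟩ : BohrSet G).carrier) :
    (smooth (⟨Γ, r⟩ : BohrSet G).carrier)^[l] (indFun (⟨Γ, s⟩ : BohrSet G).carrier) x = 1 := by
  induction l generalizing x s' with
  | zero =>
    simp only [Nat.cast_zero, zero_mul, add_zero] at hs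
    exact indFun_of_mem (carrier_subset subset_rfl hs hx)
  | succ l ih =>
    rw [Function.iterate_succ_apply', smooth]
    rw [Finset.sum_congr rfl (fun v hv => ih (s' := s' + r) (x := x - v) ?_ ?_)]
    · simp only [Finset.sum_const, nsmul_eq_mul, mul_one]
      exact div_self (card_carrier_pos _).ne'
    · refine le_trans (le_of_eq ?_) hs
      push_cast; ring
    · rw [sub_eq_add_neg]
      exact add_mem_carrier hx (neg_mem_carrier hv) le_rfl

end majorant

/-! ### The large spectrum of a regular Bohr set. -/

namespace BohrSet

variable {G : Type*} [AddCommGroup G] [Fintype G]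

/-- An element of a small dilate of a regular Bohr set almost annihilates its large spectrum. -/
theorem norm_apply_sub_one_le_of_isRegular {Γ : Finset (AddChar G ℂ)} {r s : ℝ≥0}
    (hreg : (⟨Γ, r⟩ : BohrSet G).IsRegular) {θ : ℝ} (hθ : 0 ≤ θ) (hθ1 : θ ≤ 1 / (12 * Γ.card))
    (hs : (s : ℝ) ≤ θ * r) {t : G} (ht : t ∈ (⟨Γ, s⟩ : BohrSet G).carrier) {γ : AddChar G ℂ}
    (hγ : 1 / 2 ≤ ‖muHat (⟨Γ, r⟩ : BohrSet G).carrier γ‖) : ‖γ t - 1‖ ≤ 48 * Γ.card * θ := by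
  classical
  set V := (⟨Γ, r⟩ : BohrSet G).carrier with hV
  have hVpos : (0 : ℝ) < V.card := card_carrier_pos _
  set V' := V.image fun x => x + t with hV'
  have hcard : V'.card = V.card := Finset.card_image_of_injective _ (add_left_injective t)
  -- Translating `V` by `t` multiplies the character sum by `γ t`, while regularity bounds the
  -- symmetric difference of `V` and its translate. A large sum therefore forces `γ t` close to 1.
  have hsum : ∑ x ∈ V', γ x - ∑ x ∈ V, γ x = (γ t - 1) * ∑ x ∈ V, γ x := by
    rw [hV', Finset.sum_image (fun x _ y _ h => add_left_injective t h)]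
    simp only [AddChar.map_add_eq_mul, ← Finset.sum_mul]
    ring
  have hreg1 := (hreg θ (by rw [abs_of_nonneg hθ]; exact hθ1)).2
  rw [abs_of_nonneg hθ, div_le_iff₀ hVpos] at hreg1
  simp only [rank] at hreg1
  set U := ((⟨Γ, r⟩ : BohrSet G).dilate (1 + θ).toNNReal).carrier with hU
  have hVU : V ∪ V' ⊆ U := by
    have hrad : r + s ≤ (1 + θ).toNNReal * r := by
      rw [← NNReal.coe_le_coe]
      push_cast
      rw [Real.coe_toNNReal _ (by linarith)]
      linarith
    refine Finset.union_subset (carrier_subset subset_rfl (le_trans (by simp) hrad)) ?_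
    intro y hy
    obtain ⟨x, hx, rfl⟩ := Finset.mem_image.mp hy
    exact add_mem_carrier hx ht hrad
  have hdiff : ((V' \ V).card : ℝ) ≤ 12 * Γ.card * θ * V.card := by
    have h1 := Finset.card_le_card hVU
    have h2 : (V ∪ V').card = (V' \ V).card + V.card := by
      rw [Finset.union_comm, ← Finset.card_sdiff_add_card]
    have h3 : ((V' \ V).card : ℝ) + V.card ≤ U.card := by exact_mod_cast h2 ▸ h1
    linarith
  have hnorm : ‖(γ t - 1) * ∑ x ∈ V, γ x‖ ≤ 2 * (12 * Γ.card * θ * V.card) := by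
    rw [← hsum, ← Finset.sum_sdiff_sub_sum_sdiff]
    have h1 : ∀ Y : Finset G, ‖∑ x ∈ Y, γ x‖ ≤ Y.card := fun Y => by
      refine (norm_sum_le _ _).trans ?_
      simp [AddChar.norm_apply]
    have h2 : (V \ V').card = (V' \ V).card := Finset.card_sdiff_comm hcard.symm
    refine (norm_sub_le _ _).trans ((add_le_add (h1 _) (h1 _)).trans ?_)
    rw [h2]
    linarith
  rw [norm_mul] at hnorm
  rw [muHat, norm_div, Complex.norm_natCast, le_div_iff₀ hVpos] at hγ
  have h4 := mul_le_mul_of_nonneg_left hγ (norm_nonneg (γ t - 1))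
  have h5 : ‖γ t - 1‖ * V.card ≤ (48 * Γ.card * θ) * V.card := by linarith
  exact le_of_mul_le_mul_right h5 hVpos

end BohrSet

/-! ### A local form of Chang's theorem. -/

section largeSpectrum

variable {G : Type*} [AddCommGroup G] [Fintype G]

/-- Convexity of `exp` on `[-t, t]`: the chord, normalised by `cosh t`, is a Riesz factor. -/
theorem exp_mul_le_cosh_mul {t y : ℝ} (hy : |y| ≤ 1) :
    Real.exp (t * y) ≤ Real.cosh t * (1 + Real.tanh t * y) := by
  obtain ⟨h1, h2⟩ := abs_le.mp hy
  have h3 := convexOn_exp.2 (Set.mem_univ (-t)) (Set.mem_univ t)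
    (by linarith : 0 ≤ (1 - y) / 2) (by linarith : 0 ≤ (1 + y) / 2) (by ring)
  simp only [smul_eq_mul] at h3
  have h4 : (1 - y) / 2 * -t + (1 + y) / 2 * t = t * y := by ring
  rw [h4] at h3
  refine h3.trans (le_of_eq ?_)
  rw [Real.tanh_eq_sinh_div_cosh, mul_add, mul_one, ← mul_assoc,
    mul_div_cancel₀ _ (Real.cosh_pos t).ne', Real.cosh_eq, Real.sinh_eq]
  ring

/-- A set of characters dissociated relative to a small dilate `V` on which the Fourier transform of
`X` is large has size at most logarithmic in the density of `X`. -/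
theorem card_le_of_isDissociatedRel {X V W : Finset G} (hX : X.Nonempty) {l : ℕ}
    (hmaj : ∀ x ∈ X, (smooth V)^[l] (indFun W) x = 1) {Λ : Finset (AddChar G ℂ)}
    (hΛ : IsDissociatedRel V Λ) (hspec : ∀ γ ∈ Λ, 1 / 2 ≤ ‖muHat X γ‖) (hl : Λ.card ≤ l) :
    (Λ.card : ℝ) ≤ 8 * Real.log (2 * W.card / X.card) := by
  classical
  have hXpos : (0 : ℝ) < X.card := by exact_mod_cast hX.card_pos
  set β := (smooth V)^[l] (indFun W) with hβ
  have hβ0 : ∀ x, 0 ≤ β x := smooth_iterate_nonneg V (indFun_nonneg W) l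
  have hWsum : ∑ x, β x ≤ W.card := by
    have h1 := sum_smooth_iterate_mul_addChar V (indFun W) 1 l
    have h2 : ‖∑ x, ((β x : ℝ) : ℂ) * (1 : AddChar G ℂ) x‖ ≤ W.card := by
      rw [h1, norm_mul, norm_pow]
      refine (mul_le_mul (pow_le_one₀ (norm_nonneg _) (norm_muHat_le_one V _))
        (norm_sum_indFun_mul_addChar_le W 1) (norm_nonneg _) zero_le_one).trans (by simp)
    simp only [AddChar.one_apply, mul_one] at h2
    rw [← Complex.ofReal_sum, Complex.norm_real] at h2
    exact (Real.le_norm_self _).trans h2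
  -- The phase that rotates the Fourier coefficient at `γ` onto the positive reals.
  let c : AddChar G ℂ → ℂ := fun γ => (starRingEnd ℂ) (muHat X γ) / ‖muHat X γ‖
  have hc : ∀ γ, ‖c γ‖ ≤ 1 := by
    intro γ
    simp only [c]
    rw [norm_div, Complex.norm_conj, Complex.norm_real, norm_norm]
    exact div_self_le_one _
  let Y : AddChar G ℂ → G → ℝ := fun γ x => (c γ * γ x).re
  have hY : ∀ γ x, |Y γ x| ≤ 1 := by
    intro γ x
    refine (Complex.abs_re_le_norm _).trans ?_
    rw [norm_mul, AddChar.norm_apply, mul_one]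
    exact hc γ
  have hYsum : ∀ γ ∈ Λ, (X.card : ℝ) / 2 ≤ ∑ x ∈ X, Y γ x := by
    intro γ hγ
    have h0 : ‖muHat X γ‖ ≠ 0 := by have := hspec γ hγ; linarith
    have h1 : ∑ x ∈ X, Y γ x = X.card * ‖muHat X γ‖ := by
      simp only [Y]
      rw [← Complex.re_sum, ← Finset.mul_sum]
      have h2 : ∑ x ∈ X, γ x = X.card * muHat X γ := by
        rw [muHat]
        have : (X.card : ℂ) ≠ 0 := by exact_mod_cast hXpos.ne'
        field_simp
      have h3 : c γ * ∑ x ∈ X, γ x = ((X.card * ‖muHat X γ‖ : ℝ) : ℂ) := by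
        rw [h2]
        simp only [c]
        have h4 : (starRingEnd ℂ) (muHat X γ) * muHat X γ = (‖muHat X γ‖ : ℂ) ^ 2 := by
          rw [mul_comm, Complex.mul_conj']
        have h5 : (‖muHat X γ‖ : ℂ) ≠ 0 := by exact_mod_cast h0
        push_cast
        field_simp
        linear_combination (X.card : ℂ) * h4
      rw [h3, Complex.ofReal_re]
    rw [h1]
    have := mul_le_mul_of_nonneg_left (hspec γ hγ) hXpos.le
    linarith
  -- Jensen's inequality on `X` gives exponent `t|Λ|/2` and the factors `cosh t` cost `t²|Λ|/2`; `t
  -- = 1/2` maximises the difference, at `|Λ|/8`.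
  set t : ℝ := 1 / 2 with ht
  set a := Real.tanh t with ha
  have ha0 : 0 ≤ a := by
    rw [ha, Real.tanh_eq_sinh_div_cosh]
    exact div_nonneg (Real.sinh_nonneg_iff.mpr (by norm_num)) (Real.cosh_pos _).le
  have ha1 : a ≤ 1 := by
    rw [ha, Real.tanh_eq_sinh_div_cosh]
    exact div_le_one_of_le₀ (Real.sinh_lt_cosh _).le (Real.cosh_pos _).le
  have hfac : ∀ γ x, 0 ≤ 1 + a * Y γ x := by
    intro γ x
    have := mul_le_mul ha1 (hY γ x) (abs_nonneg _) zero_le_one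
    have h2 := neg_abs_le (Y γ x)
    nlinarith
  have hriesz : ∑ x, β x * ∏ γ ∈ Λ, (1 + a * Y γ x) ≤ 2 * W.card := by
    have h1 := norm_sum_mul_rieszProduct_sub_le (β := fun x => (β x : ℂ)) ha0 hc
      (κ := (1 / 2) ^ l * W.card) Λ (fun m hm hne => by
        rw [sum_smooth_iterate_mul_addChar, norm_mul, norm_pow]
        exact mul_le_mul (pow_le_pow_left₀ (norm_nonneg _) (hΛ m hm hne) l)
          (norm_sum_indFun_mul_addChar_le W _) (norm_nonneg _) (by positivity))
    have h2 : ∑ x, (β x : ℂ) * ∏ χ ∈ Λ, rieszFactor a c χ x - ∑ x, (β x : ℂ)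
        = ((∑ x, β x * ∏ γ ∈ Λ, (1 + a * Y γ x) - ∑ x, β x : ℝ) : ℂ) := by
      simp only [rieszFactor_eq, Y]
      push_cast
      rfl
    rw [h2, Complex.norm_real] at h1
    have h3 := (Real.le_norm_self _).trans h1
    -- The `l ≥ |Λ|` smoothings give decay `2^{-l}` at nontrivial combinations, offsetting their
    -- total weight, at most `2^|Λ|`.
    have h4 : (1 / 2 : ℝ) ^ l * (1 + a) ^ Λ.card ≤ 1 := by
      calc (1 / 2 : ℝ) ^ l * (1 + a) ^ Λ.card ≤ (1 / 2 : ℝ) ^ l * 2 ^ l := by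
            gcongr
            exact (pow_le_pow_left₀ (by linarith) (by linarith : 1 + a ≤ 2) _).trans
              (pow_le_pow_right₀ (by norm_num) hl)
        _ = 1 := by rw [← mul_pow]; norm_num
    have h5 := mul_le_mul_of_nonneg_right h4 (Nat.cast_nonneg (α := ℝ) W.card)
    have h6 : 0 ≤ (1 / 2 : ℝ) ^ l * W.card := by positivity
    linarith
  have hexp : ∑ x ∈ X, Real.exp (t * ∑ γ ∈ Λ, Y γ x)
      ≤ Real.exp (Λ.card / 8) * (2 * W.card) := by
    have h1 : ∀ x, Real.exp (t * ∑ γ ∈ Λ, Y γ x)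
        ≤ Real.exp (Λ.card / 8) * ∏ γ ∈ Λ, (1 + a * Y γ x) := by
      intro x
      rw [Finset.mul_sum, Real.exp_sum]
      have h2 : (Real.cosh t) ^ Λ.card ≤ Real.exp (Λ.card / 8) := by
        calc (Real.cosh t) ^ Λ.card ≤ (Real.exp (t ^ 2 / 2)) ^ Λ.card :=
              pow_le_pow_left₀ (Real.cosh_pos _).le (Real.cosh_le_exp_half_sq t) _
          _ = Real.exp (Λ.card / 8) := by
              rw [← Real.exp_nat_mul, ht]; congr 1; ring
      calc ∏ γ ∈ Λ, Real.exp (t * Y γ x)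
          ≤ ∏ γ ∈ Λ, (Real.cosh t * (1 + a * Y γ x)) :=
            Finset.prod_le_prod (fun _ _ => (Real.exp_pos _).le)
              fun γ _ => exp_mul_le_cosh_mul (hY γ x)
        _ = Real.cosh t ^ Λ.card * ∏ γ ∈ Λ, (1 + a * Y γ x) := by
            rw [Finset.prod_mul_distrib, Finset.prod_const]
        _ ≤ _ := mul_le_mul_of_nonneg_right h2 (Finset.prod_nonneg fun γ _ => hfac γ x)
    calc ∑ x ∈ X, Real.exp (t * ∑ γ ∈ Λ, Y γ x)
        ≤ ∑ x ∈ X, Real.exp (Λ.card / 8) * (β x * ∏ γ ∈ Λ, (1 + a * Y γ x)) :=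
          Finset.sum_le_sum fun x hx => by rw [hmaj x hx, one_mul]; exact h1 x
      _ ≤ ∑ x, Real.exp (Λ.card / 8) * (β x * ∏ γ ∈ Λ, (1 + a * Y γ x)) :=
          Finset.sum_le_sum_of_subset_of_nonneg (Finset.subset_univ _) fun x _ _ =>
            mul_nonneg (Real.exp_pos _).le
              (mul_nonneg (hβ0 x) (Finset.prod_nonneg fun γ _ => hfac γ x))
      _ = Real.exp (Λ.card / 8) * ∑ x, β x * ∏ γ ∈ Λ, (1 + a * Y γ x) := by
          rw [Finset.mul_sum]
      _ ≤ _ := by gcongr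
  have hjensen : Real.exp (Λ.card / 4) * X.card ≤ ∑ x ∈ X, Real.exp (t * ∑ γ ∈ Λ, Y γ x) := by
    have h1 := convexOn_exp.map_sum_le (t := X) (w := fun _ => (1 : ℝ) / X.card)
      (p := fun x => t * ∑ γ ∈ Λ, Y γ x) (fun _ _ => by positivity)
      (by simp; field_simp) (fun _ _ => Set.mem_univ _)
    simp only [smul_eq_mul, ← Finset.mul_sum] at h1
    have h2 : (Λ.card : ℝ) / 4 ≤ 1 / X.card * (t * ∑ x ∈ X, ∑ γ ∈ Λ, Y γ x) := by
      rw [Finset.sum_comm]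
      have h3 : ∑ γ ∈ Λ, (X.card : ℝ) / 2 ≤ ∑ γ ∈ Λ, ∑ x ∈ X, Y γ x := Finset.sum_le_sum hYsum
      rw [Finset.sum_const, nsmul_eq_mul] at h3
      rw [one_div, inv_mul_eq_div, le_div_iff₀ hXpos, ht]
      linarith
    have h4 := (Real.exp_le_exp.mpr h2).trans h1
    rw [one_div, inv_mul_eq_div, le_div_iff₀ hXpos] at h4
    exact h4
  have hfinal : Real.exp (Λ.card / 8) ≤ 2 * W.card / X.card := by
    rw [le_div_iff₀ hXpos]
    have h1 := hjensen.trans hexp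
    have h2 : Real.exp (Λ.card / 4) = Real.exp (Λ.card / 8) * Real.exp (Λ.card / 8) := by
      rw [← Real.exp_add]; congr 1; ring
    rw [h2, mul_assoc] at h1
    exact le_of_mul_le_mul_left h1 (Real.exp_pos _)
  have h1 := (Real.le_log_iff_exp_le (lt_of_lt_of_le (Real.exp_pos _) hfinal)).mpr hfinal
  linarith

/-- A local version of Chang's theorem: the large spectrum of a subset of a regular Bohr set is
almost annihilated by a Bohr set of slightly larger rank. -/
theorem exists_almost_annihilating [DecidableEq (AddChar G ℂ)] {Γ : Finset (AddChar G ℂ)}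
    (hΓ : Γ.Nonempty) {ρ : ℝ≥0} (hρ : (ρ : ℝ) ≤ 1 / 4) (hreg : (⟨Γ, ρ⟩ : BohrSet G).IsRegular)
    {X : Finset G} (hX : X.Nonempty) (hXB : X ⊆ (⟨Γ, ρ⟩ : BohrSet G).carrier) {l : ℕ}
    (hl0 : 1 ≤ l)
    (hl : 8 * Real.log (4 * (⟨Γ, ρ⟩ : BohrSet G).carrier.card / X.card) < l) {κ : ℝ} (hκ : 0 < κ)
    (hκ1 : κ ≤ 1) :
    ∃ Λ : Finset (AddChar G ℂ), Λ.card ≤ l ∧ ∀ R : ℝ≥0,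
      (R : ℝ) * (93312 * (Γ.card : ℝ) ^ 2 * l) ≤ ρ * κ →
      ∀ γ : AddChar G ℂ, 1 / 2 ≤ ‖muHat X γ‖ → ∀ t ∈ (⟨Γ ∪ Λ, R⟩ : BohrSet G).carrier,
        ‖γ t - 1‖ ≤ κ := by
  have hd : (1 : ℝ) ≤ Γ.card := by exact_mod_cast hΓ.card_pos
  have hd0 : (0 : ℝ) < Γ.card := by linarith
  have hl1 : (1 : ℝ) ≤ l := by exact_mod_cast hl0
  have hl0' : (0 : ℝ) < l := by linarith
  have hXpos : (0 : ℝ) < X.card := by exact_mod_cast hX.card_pos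
  -- Chosen so that `l` smoothings enlarge the radius by a factor of at most `1 + 1/(12|Γ|)`, the
  -- limit of the regularity window; hence `|W| ≤ 2|B|`.
  let q : ℝ≥0 := (1 / (12 * (Γ.card : ℝ) * l)).toNNReal
  have hq : (q : ℝ) = 1 / (12 * Γ.card * l) := Real.coe_toNNReal _ (by positivity)
  have hq1 : (q : ℝ) ≤ 1 := by
    rw [hq, div_le_one (by positivity)]
    nlinarith
  have hqρ : ((q * ρ : ℝ≥0) : ℝ) = ρ / (12 * Γ.card * l) := by
    rw [NNReal.coe_mul, hq]; ring
  obtain ⟨r, hr1, hr2, hrreg⟩ := BohrSet.exists_isRegular (G := G) hΓ (R := q * ρ) (by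
    rw [NNReal.coe_mul]
    have := mul_le_mul_of_nonneg_right hq1 ρ.coe_nonneg
    linarith)
  set V := (⟨Γ, r⟩ : BohrSet G).carrier with hV
  set W := (⟨Γ, ρ + l * r⟩ : BohrSet G).carrier with hW
  have hmaj : ∀ x ∈ X, (smooth V)^[l] (indFun W) x = 1 := fun x hx =>
    BohrSet.smooth_iterate_indFun_eq_one l le_rfl (hXB hx)
  have hWcard : (W.card : ℝ) ≤ 2 * (⟨Γ, ρ⟩ : BohrSet G).carrier.card := by
    have hθ : (0 : ℝ) ≤ 1 / (12 * Γ.card) := by positivity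
    have h1 := (hreg (1 / (12 * Γ.card)) (by
      rw [abs_of_nonneg hθ]; simp only [BohrSet.rank]; exact le_rfl)).2
    rw [abs_of_nonneg hθ, div_le_iff₀ (BohrSet.card_carrier_pos _)] at h1
    simp only [BohrSet.rank] at h1
    rw [mul_one_div_cancel (by positivity)] at h1
    have h2 : W ⊆ ((⟨Γ, ρ⟩ : BohrSet G).dilate (1 + 1 / (12 * (Γ.card : ℝ))).toNNReal).carrier := by
      refine BohrSet.carrier_subset subset_rfl ?_
      have h3 : (r : ℝ) ≤ ρ / (12 * Γ.card * l) := by rw [← hqρ]; exact_mod_cast hr2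
      rw [← NNReal.coe_le_coe]
      push_cast
      rw [Real.coe_toNNReal _ (by positivity)]
      have h4 := mul_le_mul_of_nonneg_left h3 hl0'.le
      have h5 : (l : ℝ) * (ρ / (12 * Γ.card * l)) = 1 / (12 * Γ.card) * ρ := by
        field_simp
      linarith
    have h3 : (W.card : ℝ) ≤ _ := Nat.cast_le.mpr (Finset.card_le_card h2)
    linarith
  obtain ⟨Λ, hΛΔ, hΛd, hΛ⟩ := exists_dissociated_spanning V
    (Finset.univ.filter fun γ : AddChar G ℂ => 1 / 2 ≤ ‖muHat X γ‖)
  have hspec : ∀ γ ∈ Λ, 1 / 2 ≤ ‖muHat X γ‖ := fun γ hγ => (Finset.mem_filter.mp (hΛΔ hγ)).2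
  have hlog : 8 * Real.log (2 * W.card / X.card) < l := by
    refine lt_of_le_of_lt ?_ hl
    have hWpos : (0 : ℝ) < W.card := BohrSet.card_carrier_pos _
    refine mul_le_mul_of_nonneg_left (Real.log_le_log (by positivity) ?_) (by norm_num)
    exact div_le_div_of_nonneg_right (by linarith) hXpos.le
  -- The size bound presupposes at most `l` characters, so it is applied to a subset of exactly `l`,
  -- where it contradicts `hlog`.
  have hcard : Λ.card ≤ l := by
    by_contra! hlt
    obtain ⟨Λ', hΛ', hcard'⟩ := Finset.exists_subset_card_eq hlt.le
    have h1 := card_le_of_isDissociatedRel hX hmaj (hΛd.subset hΛ')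
      (fun γ hγ => hspec γ (hΛ' hγ)) hcard'.le
    rw [hcard'] at h1
    linarith
  refine ⟨Λ, hcard, fun R hR γ hγ t ht => ?_⟩
  have hRsmall : (R : ℝ) * (l * 2) ≤ κ := by
    have h1 : (R : ℝ) * (l * 2) ≤ R * (93312 * (Γ.card : ℝ) ^ 2 * l) := by
      have : (1 : ℝ) ≤ (Γ.card : ℝ) ^ 2 := one_le_pow₀ hd
      refine mul_le_mul_of_nonneg_left ?_ R.coe_nonneg
      nlinarith
    have h2 : (ρ : ℝ) * κ ≤ 1 * κ := by gcongr; linarith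
    linarith
  have h1 := hΛ t (κ / 2) (κ / 2) (by positivity) (fun χ hχ => by
    -- This `θ` makes `48|Γ|θ = κ/2`. The constant `93312 = 96 · 12 · 81` collects `θ`, `q` and the
    -- loss in choosing the regular radius `r`.
    have h2 := BohrSet.norm_apply_sub_one_le_of_isRegular hrreg (θ := κ / (96 * Γ.card))
      (s := R) (t := t) (by positivity) (by
        rw [div_le_div_iff₀ (by positivity) (by positivity)]
        nlinarith) (by
        have h3 : (ρ : ℝ) / (12 * Γ.card * l) / 81 ≤ r := by rw [← hqρ]; exact hr1
        have h4 := mul_le_mul_of_nonneg_left h3 (by positivity : 0 ≤ κ / (96 * Γ.card))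
        refine le_trans ?_ h4
        have h5 : κ / (96 * Γ.card) * ((ρ : ℝ) / (12 * Γ.card * l) / 81)
            = ρ * κ / (93312 * (Γ.card : ℝ) ^ 2 * l) := by
          field_simp; ring
        rw [h5, le_div_iff₀ (by positivity)]
        exact hR) (BohrSet.carrier_subset Finset.subset_union_left le_rfl ht) hχ
    refine h2.trans (le_of_eq ?_)
    field_simp
    norm_num) (by
    have h2 : ∑ χ ∈ Λ, ‖χ t - 1‖ ≤ ∑ χ ∈ Λ, (R : ℝ) := Finset.sum_le_sum fun χ hχ =>
      BohrSet.mem_carrier.mp ht χ (Finset.mem_union_right _ hχ)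
    rw [Finset.sum_const, nsmul_eq_mul] at h2
    have h3 : (Λ.card : ℝ) * R ≤ l * R := by gcongr
    linarith) γ (by simpa using hγ)
  linarith

end largeSpectrum

/-! ### From the smoothed function back to `g`. -/

section translates

variable {G : Type*} [AddCommGroup G] [Fintype G]

/-- A regular Bohr set is only slightly larger than a slightly smaller dilate. -/
theorem BohrSet.card_sdiff_le_of_isRegular [DecidableEq G] {B : BohrSet G} (hB : B.IsRegular)
    {s : ℝ} (hs : 0 ≤ s) (hs1 : s ≤ 1 / (12 * B.rank)) :
    ((B.carrier \ (⟨B.freq, (1 - s).toNNReal * B.radius⟩ : BohrSet G).carrier).card : ℝ)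
      ≤ 12 * B.rank * s * B.carrier.card := by
  have h1 := (hB (-s) (by rw [abs_neg, abs_of_nonneg hs]; exact hs1)).1
  rw [abs_neg, abs_of_nonneg hs, le_div_iff₀ B.card_carrier_pos, ← sub_eq_add_neg] at h1
  simp only [dilate] at h1
  have hsub : (⟨B.freq, (1 - s).toNNReal * B.radius⟩ : BohrSet G).carrier ⊆ B.carrier := by
    refine carrier_subset (s := B.radius) subset_rfl ?_
    refine mul_le_of_le_one_left zero_le ?_
    rw [Real.toNNReal_le_one]
    linarith
  rw [Finset.card_sdiff_of_subset hsub, Nat.cast_sub (Finset.card_le_card hsub)]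
  linarith

/-- The smoothing argument: if many translates of `F` approximate `g` in norm and the iterated
difference average of `g` is almost invariant under `t`, then so is `g`. -/
theorem lpSum_translate_sub_le [DecidableEq G] {p : ℝ} (hp : 1 ≤ p) {B : BohrSet G} {τ : ℝ≥0}
    {k : ℕ} (hτ : (2 * k + 3) * (τ : ℝ) ≤ 1) {X : Finset G} (hX : X.Nonempty)
    (hXB : X ⊆ (B.dilate τ).carrier) {g F : G → ℝ} {D ω υ : ℝ}
    (hF : ∀ s ∈ X, lpSum p B.carrier (fun x => F (x + s) - g x) ≤ D)
    (hg : ∀ x y, |g x - g y| ≤ 1) {t : G} (ht : t ∈ (B.dilate τ).carrier) (hω0 : 0 ≤ ω)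
    (hω : ∀ x, |(diffAverage X)^[k] g (x + t) - (diffAverage X)^[k] g x| ≤ ω) (hυ0 : 0 ≤ υ)
    (hυ : ((B.carrier \
      (⟨B.freq, (1 - (2 * k + 3) * (τ : ℝ)).toNNReal * B.radius⟩ : BohrSet G).carrier).card : ℝ)
        ≤ υ ^ p * B.carrier.card) :
    lpSum p B.carrier (fun x => g (x + t) - g x)
      ≤ 4 * k * D + (ω + υ) * (B.carrier.card : ℝ) ^ (1 / p) := by
  have hp0 : 0 < p := by linarith
  have hτ0 : (0 : ℝ) ≤ τ := τ.coe_nonneg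
  -- Already `E 0` is shrunk by `2τ`, so that moving by `X - X` stays inside `B`; each further step
  -- costs `2τ`. The extra `τ` in `E'` leaves room for `t`.
  let E : ℕ → Finset G := fun j =>
    (⟨B.freq, (1 - 2 * (j + 1) * (τ : ℝ)).toNNReal * B.radius⟩ : BohrSet G).carrier
  set E' := (⟨B.freq, (1 - (2 * k + 3) * (τ : ℝ)).toNNReal * B.radius⟩ : BohrSet G).carrier
  have hEB : ∀ u : ℝ, 0 ≤ u →
      (⟨B.freq, (1 - u).toNNReal * B.radius⟩ : BohrSet G).carrier ⊆ B.carrier := by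
    intro u hu
    refine BohrSet.carrier_subset (s := B.radius) subset_rfl ?_
    refine mul_le_of_le_one_left zero_le ?_
    rw [Real.toNNReal_le_one]
    linarith
  have hadd : ∀ u v : ℝ, 0 ≤ 1 - v → u + τ ≤ v → ∀ {x y : G},
      x ∈ (⟨B.freq, (1 - v).toNNReal * B.radius⟩ : BohrSet G).carrier →
      y ∈ (B.dilate τ).carrier →
      x + y ∈ (⟨B.freq, (1 - u).toNNReal * B.radius⟩ : BohrSet G).carrier := by
    intro u v hv huv x y hx hy
    refine BohrSet.add_mem_carrier hx hy ?_
    rw [← add_mul]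
    refine mul_le_mul_left ?_ _
    rw [← NNReal.coe_le_coe, NNReal.coe_add, Real.coe_toNNReal _ hv,
      Real.coe_toNNReal _ (by linarith)]
    linarith
  have hadd2 : ∀ u v : ℝ, 0 ≤ 1 - v → u + 2 * τ ≤ v → ∀ {x y z : G},
      x ∈ (⟨B.freq, (1 - v).toNNReal * B.radius⟩ : BohrSet G).carrier →
      y ∈ X → z ∈ X →
      x + (y - z) ∈ (⟨B.freq, (1 - u).toNNReal * B.radius⟩ : BohrSet G).carrier := by
    intro u v hv huv x y z hx hy hz
    have e : x + (y - z) = x + y + -z := by abel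
    rw [e]
    exact hadd u (u + τ) (by linarith) le_rfl
      (hadd (u + τ) v hv (by linarith) hx (hXB hy)) (BohrSet.neg_mem_carrier (hXB hz))
  have hk0 : (0 : ℝ) ≤ k := Nat.cast_nonneg k
  have hkτ : 0 ≤ (k : ℝ) * τ := by positivity
  have hdiff : ∀ s ∈ X, ∀ s' ∈ X,
      lpSum p (E 0) (fun x => g (x + (s - s')) - g x) ≤ 2 * D := by
    intro s hs s' hs'
    refine lpSum_diff_le hp hF (hEB _ (by positivity)) ?_ hs hs'
    intro x hx y hy z hz
    have := hadd2 0 _ (by push_cast; linarith) (by push_cast; linarith) hx hy hz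
    simpa using this
  have hiter := lpSum_diffAverage_iterate_sub_le hp hX (k := k) E (fun j => by
      refine BohrSet.carrier_subset subset_rfl (mul_le_mul_left ?_ _)
      refine Real.toNNReal_le_toNNReal ?_
      push_cast
      have : 0 ≤ (j : ℝ) * τ := by positivity
      linarith)
    (fun j hj x hx s hs s' hs' => by
      have hjk : (j : ℝ) + 1 ≤ k := by exact_mod_cast hj
      have := mul_le_mul_of_nonneg_right hjk hτ0
      exact hadd2 _ _ (by push_cast; linarith) (by push_cast; linarith) hx hs hs') hdiff
  set P := (diffAverage X)^[k] g
  have hE'E : E' ⊆ E k := by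
    refine BohrSet.carrier_subset subset_rfl (mul_le_mul_left ?_ _)
    refine Real.toNNReal_le_toNNReal ?_
    linarith
  have hmain1 : lpSum p E' (fun x => P x - g x) ≤ k * (2 * D) :=
    (lpSum_mono hp0.le hE'E _).trans hiter
  have hmain2 : lpSum p E' (fun x => -(P (x + t) - g (x + t))) ≤ k * (2 * D) := by
    refine le_trans (le_of_eq (lpSum_congr fun x _ => abs_neg _))
      (le_trans (lpSum_comp_le hp0.le (fun x => x + t) (add_left_injective t) (fun x hx => ?_)
        (fun x => P x - g x)) hiter)
    exact hadd _ _ (by linarith) (by linarith) hx ht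
  have hmain3 : lpSum p E' (fun x => P (x + t) - P x) ≤ ω * (B.carrier.card : ℝ) ^ (1 / p) :=
    (lpSum_mono hp0.le (hEB _ (by positivity)) _).trans
      (lpSum_le_of_abs_le hp0 hω0 fun x _ => hω x)
  -- On the boundary layer only the trivial bound 1 is available; the smallness comes from the
  -- measure of the layer.
  have hmain4 : lpSum p (B.carrier \ E') (fun x => g (x + t) - g x)
      ≤ υ * (B.carrier.card : ℝ) ^ (1 / p) := by
    refine (lpSum_le_of_abs_le hp0 zero_le_one fun x _ => hg _ _).trans ?_
    rw [one_mul]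
    refine (Real.rpow_le_rpow (Nat.cast_nonneg _) hυ (by positivity)).trans (le_of_eq ?_)
    rw [Real.mul_rpow (by positivity) (by positivity), ← Real.rpow_mul hυ0,
      mul_one_div_cancel hp0.ne', Real.rpow_one]
  have h1 := lpSum_le_add_sdiff hp B.carrier E' (fun x => g (x + t) - g x)
  have h2 : lpSum p E' (fun x => g (x + t) - g x)
      ≤ k * (2 * D) + (ω * (B.carrier.card : ℝ) ^ (1 / p) + k * (2 * D)) := by
    have e : (fun x => g (x + t) - g x)
        = fun x => -(P (x + t) - g (x + t)) + ((P (x + t) - P x) + (P x - g x)) := by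
      funext x; ring
    rw [e]
    refine (lpSum_add_le hp E' _ _).trans (add_le_add hmain2 ?_)
    exact (lpSum_add_le hp E' _ _).trans (add_le_add hmain3 hmain1)
  linarith

/-- Convolution with `μ_T` averages the translates by `-t`, so symmetry of `T` and the triangle
inequality suffice. -/
theorem avgLpNorm_conv_muFun_sub_le {p : ℝ} (hp : 1 ≤ p) {E T : Finset G} (hT : T.Nonempty)
    (hneg : ∀ t ∈ T, -t ∈ T) {g : G → ℝ} {D : ℝ}
    (h : ∀ t ∈ T, avgLpNorm p E (fun x => g (x + t) - g x) ≤ D) :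
    avgLpNorm p E (fun x => conv g (muFun T) x - g x) ≤ D := by
  rcases E.eq_empty_or_nonempty with rfl | hE
  · obtain ⟨t, ht⟩ := hT
    simpa [avgLpNorm] using h t ht
  have hc : (0 : ℝ) < (E.card : ℝ) ^ (1 / p) :=
    Real.rpow_pos_of_pos (by exact_mod_cast hE.card_pos) _
  simp only [avgLpNorm_eq, div_le_iff₀ hc] at h ⊢
  have hTc : (T.card : ℝ) ≠ 0 := by exact_mod_cast hT.card_pos.ne'
  have h1 := lpSum_average_le hp E hT (fun t x => g (x + -t) - g x)
    (fun t ht => h (-t) (hneg t ht))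
  refine le_trans (le_of_eq (lpSum_congr fun x _ => ?_)) h1
  rw [conv_muFun_right, Finset.sum_sub_distrib, sub_div, Finset.sum_const, nsmul_eq_mul,
    mul_div_cancel_left₀ _ hTc]
  simp only [sub_eq_add_neg]

-- All terms carry the same power `|E|^{1/(2m)}` on normalisation.
omit [AddCommGroup G] [Fintype G] in
theorem avgLpNorm_rescale {m : ℝ} (hm : 1 ≤ m) {E : Finset G} (hE : E.Nonempty) {ε δ N : ℝ}
    (h f : G → ℝ)
    (hN : lpSum (2 * m) E h ≤ ε * lpSum m E f ^ (1 / 2 : ℝ)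
      + N * lpSum 1 E f ^ (1 / (2 * m)) + δ * (E.card : ℝ) ^ (1 / (2 * m))) :
    avgLpNorm (2 * m) E h ≤ ε * avgLpNorm m E f ^ (1 / 2 : ℝ)
      + N * avgLpNorm 1 E f ^ (1 / (2 * m)) + δ := by
  have hE0 : (0 : ℝ) < E.card := by exact_mod_cast hE.card_pos
  have hc : (0 : ℝ) < (E.card : ℝ) ^ (1 / (2 * m)) := Real.rpow_pos_of_pos hE0 _
  have hm0 : 0 < m := by linarith
  rw [avgLpNorm_eq, avgLpNorm_eq, avgLpNorm_eq, div_le_iff₀ hc,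
    Real.div_rpow (lpSum_nonneg _ _ _) (by positivity),
    Real.div_rpow (lpSum_nonneg _ _ _) (by positivity), ← Real.rpow_mul hE0.le,
    ← Real.rpow_mul hE0.le]
  have e1 : 1 / m * (1 / 2) = 1 / (2 * m) := by field_simp
  have e2 : 1 / 1 * (1 / (2 * m)) = 1 / (2 * m) := by ring
  rw [e1, e2]
  refine hN.trans (le_of_eq ?_)
  field_simp

end translates

/-! ### Numerical choices of parameters. -/

section parameters

theorem le_log_two_div_of_le_one {y : ℝ} (hy : 0 < y) (hy1 : y ≤ 1) :
    69 / 100 ≤ Real.log (2 / y) := by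
  have h1 : Real.log 2 ≤ Real.log (2 / y) := by
    refine Real.log_le_log (by norm_num) ?_
    rw [le_div_iff₀ hy]; linarith
  have := Real.log_two_gt_d9
  linarith

/-- With `ℓ = log (2/δη)` and `k = ⌈4ℓ⌉`, one has `4^{-k} ≤ (δη/2)^4 ≤ δ√η/16`, which offsets the
`ℓ¹` norm `η^{-1/2}` of the Fourier coefficients. -/
theorem exists_iteration_count {δ η : ℝ} (hδ : 0 < δ) (hδ1 : δ < 1) (hη : 0 < η) (hη1 : η ≤ 1) :
    ∃ k : ℕ, 1 ≤ k ∧ (k : ℝ) ≤ 6 * Real.log (2 / (δ * η)) ∧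
      (Real.sqrt η)⁻¹ * (δ * Real.sqrt η / 8 + 2 * (1 / 4) ^ k) ≤ δ / 4 := by
  have hy : 0 < δ * η := by positivity
  have hy1 : δ * η ≤ 1 := mul_le_one₀ hδ1.le hη.le hη1
  have hl := le_log_two_div_of_le_one hy hy1
  set ℓ := Real.log (2 / (δ * η)) with hℓ
  have hs : 0 < Real.sqrt η := Real.sqrt_pos.mpr hη
  have hsη : η ≤ Real.sqrt η := by
    have h1 : Real.sqrt η ≤ 1 := Real.sqrt_le_one.mpr hη1
    have h2 := Real.mul_self_sqrt hη.le
    nlinarith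
  have hceil : 4 * ℓ ≤ (⌈4 * ℓ⌉₊ : ℝ) := Nat.le_ceil _
  refine ⟨⌈4 * ℓ⌉₊, Nat.one_le_ceil_iff.mpr (by linarith), ?_, ?_⟩
  · have := Nat.ceil_lt_add_one (by linarith : 0 ≤ 4 * ℓ)
    linarith
  · have h1 : (1 / 4 : ℝ) ^ ⌈4 * ℓ⌉₊ ≤ Real.exp (-(4 * ℓ)) := by
      have h2 : (1 / 4 : ℝ) ≤ Real.exp (-1) := by
        rw [Real.exp_neg, one_div]
        refine inv_anti₀ (Real.exp_pos 1) ?_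
        have := Real.exp_one_lt_d9; linarith
      calc (1 / 4 : ℝ) ^ ⌈4 * ℓ⌉₊ ≤ Real.exp (-1) ^ ⌈4 * ℓ⌉₊ :=
            pow_le_pow_left₀ (by norm_num) h2 _
        _ = Real.exp (-⌈4 * ℓ⌉₊) := by rw [← Real.exp_nat_mul]; congr 1; ring
        _ ≤ _ := Real.exp_le_exp.mpr (by linarith)
    have h3 : Real.exp (-(4 * ℓ)) = (δ * η / 2) ^ 4 := by
      have h4 : Real.exp (-ℓ) = δ * η / 2 := by
        rw [Real.exp_neg, hℓ, Real.exp_log (by positivity), inv_div]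
      rw [← h4, ← Real.exp_nat_mul]
      congr 1
      push_cast
      ring
    have h5 : (δ * η / 2) ^ 4 ≤ δ * η / 16 := by
      have h6 : (δ * η) ^ 4 ≤ δ * η := by
        simpa using pow_le_pow_of_le_one hy.le hy1 (by norm_num : 1 ≤ 4)
      rw [div_pow]
      linarith
    have h7 : δ * η ≤ δ * Real.sqrt η := by gcongr
    rw [inv_mul_le_iff₀ hs]
    linarith

/-- The factor `4 · 2 = 2³` accounts for the 3 in `n + 3`. -/
theorem log_density_le {b x s K : ℝ} {n : ℕ} (hb : 0 < b) (hx : 0 < x) (hs : 0 < s) (hK : 1 ≤ K)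
    (h : s ≤ 2 * K ^ n * x) :
    Real.log (4 * b / x) ≤ (n + 3) * Real.log (2 * K) + Real.log (1 / (s / b)) := by
  have h1 : 4 * b / x ≤ (2 * K) ^ (n + 3) * (1 / (s / b)) := by
    rw [one_div_div, ← mul_div_assoc, div_le_div_iff₀ hx hs]
    have h2 : 8 * K ^ n ≤ (2 * K) ^ (n + 3) := by
      calc 8 * K ^ n = 2 ^ 3 * K ^ n := by norm_num
        _ ≤ (2 * K) ^ 3 * (2 * K) ^ n := by
            gcongr <;> linarith
        _ = _ := by ring
    have h3 := mul_le_mul_of_nonneg_left h (by positivity : 0 ≤ 4 * b)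
    have h4 := mul_le_mul_of_nonneg_right h2 (by positivity : 0 ≤ b * x)
    linarith
  refine (Real.log_le_log (by positivity) h1).trans (le_of_eq ?_)
  rw [Real.log_mul (by positivity) (by positivity), Real.log_pow]
  push_cast
  ring

/-- Because `2 - 1/m ≥ 1`, sampling at accuracy `ε / N` absorbs a later loss of `N` in the second
error term too. -/
theorem mul_rpow_scale_le {m ε N : ℝ} (hm : 1 ≤ m) (hε : 0 < ε) (hN : 1 ≤ N) :
    N * (ε / N) ^ (2 - 1 / m) ≤ ε ^ (2 - 1 / m) := by
  have hN0 : 0 < N := by linarith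
  have h1 : 1 ≤ 2 - 1 / m := by
    have : 1 / m ≤ 1 := by rw [div_le_one (by linarith)]; exact hm
    linarith
  have h2 : N ≤ N ^ (2 - 1 / m) := by
    simpa using Real.rpow_le_rpow_of_exponent_le hN h1
  rw [Real.div_rpow hε.le hN0.le, ← mul_div_assoc, div_le_iff₀ (by positivity), mul_comm]
  gcongr

/-- The boundary layer has relative size at most `12 d (2k + 3) τ ≤ 204 dτℓ`. Its `2m`-th root must
be at most `δ/4`, which forces `τ` to be exponentially small in `m`; `864 ≥ 4 · 204`. -/
theorem boundary_parameter_le {m δ d τ ℓ : ℝ} (hm : 1 ≤ m) (hδ : 0 < δ) (hδ1 : δ < 1) (hd : 1 ≤ d)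
    (hℓ : 69 / 100 ≤ ℓ) (hτ : τ ≤ (1 / 864 * δ) ^ (2 * m) / (d * ℓ)) :
    d * τ * ℓ ≤ 1 / 700000 ∧ 204 * (d * τ * ℓ) ≤ (δ / 4) ^ (2 * m) := by
  have hℓ0 : 0 < ℓ := by linarith
  have hd0 : 0 < d := by linarith
  rw [le_div_iff₀ (by positivity)] at hτ
  have h1 : d * τ * ℓ ≤ (1 / 864 * δ) ^ (2 * m) := by linarith
  constructor
  · have h2 : (1 / 864 * δ) ^ (2 * m) ≤ (1 / 864 * δ) ^ (2 : ℝ) :=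
      Real.rpow_le_rpow_of_exponent_ge (by positivity) (by linarith) (by linarith)
    rw [Real.rpow_two] at h2
    nlinarith
  · have h2 : (204 : ℝ) ≤ 204 ^ (2 * m) := by
      simpa using Real.rpow_le_rpow_of_exponent_le (by norm_num : (1 : ℝ) ≤ 204)
        (by linarith : 1 ≤ 2 * m)
    calc 204 * (d * τ * ℓ) ≤ 204 ^ (2 * m) * (1 / 864 * δ) ^ (2 * m) :=
          (mul_le_mul_of_nonneg_left h1 (by norm_num)).trans
            (mul_le_mul_of_nonneg_right h2 (by positivity))
      _ = (204 * (1 / 864 * δ)) ^ (2 * m) :=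
          (Real.mul_rpow (by norm_num) (by positivity)).symm
      _ ≤ (δ / 4) ^ (2 * m) := by
          refine Real.rpow_le_rpow (by positivity) ?_ (by linarith)
          linarith

/-- Sampling at accuracy `ε / (8k)` with `k ≤ 6ℓ` is what produces `ℓ²`; the lower bounds on `ℓ` and
`Lk` absorb additive constants. -/
theorem rank_parameter_le {m ε ℓ Lk σ : ℝ} {k n l : ℕ} (hm : 1 ≤ m) (hε : 0 < ε) (hε1 : ε < 1)
    (hℓ : 69 / 100 ≤ ℓ) (hLk : 69 / 100 ≤ Lk) (hσ : 0 ≤ σ) (hk : (k : ℝ) ≤ 6 * ℓ)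
    (hk1 : 1 ≤ k) (hn : (n : ℝ) ≤ 192 * m / (ε / (8 * k)) ^ 2 + 1)
    (hl : (l : ℝ) ≤ 8 * ((n + 3) * Lk + σ) + 1) :
    (l : ℝ) ≤ 4000000 * (m * (1 / ε ^ 2) * ℓ ^ 2 * Lk + σ) := by
  have hk0 : (0 : ℝ) < k := by exact_mod_cast hk1
  set Q := m * (1 / ε ^ 2) * ℓ ^ 2 with hQ
  have h1 : 192 * m / (ε / (8 * k)) ^ 2 ≤ 442368 * Q := by
    have e : 192 * m / (ε / (8 * k)) ^ 2 = 12288 * (m * (1 / ε ^ 2)) * (k : ℝ) ^ 2 := by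
      field_simp; norm_num
    have h2 : (k : ℝ) ^ 2 ≤ (6 * ℓ) ^ 2 := pow_le_pow_left₀ hk0.le hk 2
    rw [e, hQ]
    have := mul_le_mul_of_nonneg_left h2 (by positivity : 0 ≤ 12288 * (m * (1 / ε ^ 2)))
    linarith
  have hQ1 : 47 / 100 ≤ Q := by
    have h2 : 1 ≤ 1 / ε ^ 2 := by
      rw [le_div_iff₀ (by positivity), one_mul]
      exact pow_le_one₀ hε.le hε1.le
    have h3 : 1 ≤ m * (1 / ε ^ 2) := one_le_mul_of_one_le_of_one_le hm h2
    have h4 : 47 / 100 ≤ ℓ ^ 2 := by nlinarith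
    rw [hQ]
    nlinarith
  have h5 : (n + 3 : ℝ) * Lk ≤ (442368 * Q + 9 * Q) * Lk := by
    refine mul_le_mul_of_nonneg_right ?_ (by linarith)
    linarith
  have h6 : 1 ≤ 4 * (Q * Lk) := by nlinarith
  have h7 : 0 ≤ Q * Lk := by positivity
  linarith

theorem radius_parameter_le {ρ τ δ s d l Q : ℝ} (hρ : 0 ≤ ρ) (hτ : 0 ≤ τ) (hδ : 0 ≤ δ)
    (hs : 0 ≤ s) (hd : 0 < d) (hl : 0 < l) (hQ : l ≤ 4000000 * Q) :
    ρ * τ * δ * s / (d ^ 2 * (10 ^ 15 * Q))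
      ≤ τ * ρ * (δ * s / 8) / (93312 * d ^ 2 * l) / 81 := by
  have hd2 : 0 < d ^ 2 := by positivity
  have e : τ * ρ * (δ * s / 8) / (93312 * d ^ 2 * l) / 81
      = ρ * τ * δ * s / (d ^ 2 * (60466176 * l)) := by
    field_simp
    ring
  rw [e]
  refine div_le_div_of_nonneg_left (by positivity) (by positivity) ?_
  exact mul_le_mul_of_nonneg_left (by linarith) hd2.le

end parameters

/-! ### Assembly of the theorem. -/

theorem sqrt_mul_sqrt_eq_inv_sqrt {G : Type*} [Fintype G] {A L : Finset G} (hA : A.Nonempty)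
    {η : ℝ} (hη : η = (A.card : ℝ) / L.card) :
    Real.sqrt (∑ x, muFun A x ^ 2) * Real.sqrt (∑ x, indFun L x ^ 2) = (Real.sqrt η)⁻¹ := by
  rw [sum_muFun_sq hA, sum_indFun_sq, ← Real.sqrt_mul (by positivity), ← Real.sqrt_inv, hη,
    inv_div, one_div_mul_eq_div]

theorem mainTheorem5 :
    ∃ c : ℝ, 0 < c ∧ ∃ C : ℝ, 0 < C ∧
      ∀ (G : Type*) [AddCommGroup G] [Fintype G] [DecidableEq G]
        (m ε δ η K : ℝ) (A L S : Finset G) (B : BohrSet G) (τ : ℝ≥0),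
        1 ≤ m → 0 < ε → ε < 1 → 0 < δ → δ < 1 →
        A.Nonempty → L.Nonempty → S.Nonempty →
        η = (A.card : ℝ) / (L.card : ℝ) → η ≤ 1 →
        1 ≤ B.rank → B.radius ≤ 2 →
        B.IsRegular → (B.dilate τ).IsRegular →
        (τ : ℝ) ≤ (c * δ) ^ (2 * m) / ((B.rank : ℝ) * Real.log (2 / (δ * η))) →
        S ⊆ (B.dilate τ).carrier →
        ((A + S).card : ℝ) ≤ K * (A.card : ℝ) →
        ∃ (d' : ℝ) (T : BohrSet G),
          0 < d' ∧
          d' ≤ C * (m * (1 / ε ^ 2) * Real.log (2 / (δ * η)) ^ 2 * Real.log (2 * K)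
              + Real.log (1 / ((S.card : ℝ) / ((B.dilate τ).carrier.card : ℝ)))) ∧
          T.IsRegular ∧ T.IsSub (B.dilate τ) ∧
          (T.rank : ℝ) ≤ (B.rank : ℝ) + d' ∧
          (B.radius : ℝ) * (τ : ℝ) * δ * η ^ (1 / 2 : ℝ) / ((B.rank : ℝ) ^ 2 * d')
            ≤ (T.radius : ℝ) ∧
          (let g : G → ℝ := conv (muFun A) (indFun L)
           let f : G → ℝ := fun x => g x * (1 - g x)
           let bound : ℝ :=
             ε * avgLpNorm m B.carrier f ^ (1 / 2 : ℝ)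
               + ε ^ (2 - 1 / m) * avgLpNorm 1 B.carrier f ^ (1 / (2 * m)) + δ
           (∀ t ∈ T.carrier, avgLpNorm (2 * m) B.carrier (fun x => g (x + t) - g x) ≤ bound) ∧
           avgLpNorm (2 * m) B.carrier
             (fun x => conv g (muFun T.carrier) x - g x) ≤ bound) := by
  refine ⟨1 / 864, by norm_num, 10 ^ 15, by norm_num, ?_⟩
  intro G _ _ _ m ε δ η K A L S B τ hm hε hε1 hδ hδ1 hA hL hS hη hη1 hd hρ hBreg hBτreg hτ hSB hK
  classical
  have hAc : (0 : ℝ) < A.card := by exact_mod_cast hA.card_pos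
  have hLc : (0 : ℝ) < L.card := by exact_mod_cast hL.card_pos
  have hSc : (0 : ℝ) < S.card := by exact_mod_cast hS.card_pos
  have hη0 : 0 < η := by rw [hη]; positivity
  have hsη : 0 < Real.sqrt η := Real.sqrt_pos.mpr hη0
  have hdR : (1 : ℝ) ≤ B.rank := by exact_mod_cast hd
  have hΓ : B.freq.Nonempty := Finset.card_pos.mp hd
  have hℓ := le_log_two_div_of_le_one (mul_pos hδ hη0) (mul_le_one₀ hδ1.le hη0.le hη1)
  obtain ⟨k, hk1, hk, hkbound⟩ := exists_iteration_count hδ hδ1 hη0 hη1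
  set ℓ := Real.log (2 / (δ * η))
  have hk1R : (1 : ℝ) ≤ k := by exact_mod_cast hk1
  have hK1 : 1 ≤ K := by
    have h1 : (A.card : ℝ) ≤ (A + S).card := by
      exact_mod_cast Finset.card_le_card_add_right hS
    have h2 : 1 * (A.card : ℝ) ≤ K * A.card := by linarith
    exact le_of_mul_le_mul_right h2 hAc
  have hLk : 69 / 100 ≤ Real.log (2 * K) := by
    have h1 : Real.log 2 ≤ Real.log (2 * K) := Real.log_le_log (by norm_num) (by linarith)
    have := Real.log_two_gt_d9
    linarith
  set B' := B.dilate τ with hB'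
  have hB'c := B'.card_carrier_pos
  set σ := Real.log (1 / ((S.card : ℝ) / (B'.carrier.card : ℝ)))
  have hσ : 0 ≤ σ := by
    refine Real.log_nonneg ?_
    rw [one_div_div, one_le_div hSc]
    exact_mod_cast Finset.card_le_card hSB
  obtain ⟨hb1, hb2⟩ := boundary_parameter_le hm hδ hδ1 hdR hℓ hτ
  have hτ0 : (0 : ℝ) ≤ τ := τ.coe_nonneg
  have hdτ : 0 ≤ (B.rank : ℝ) * τ := by positivity
  have hτd : (τ : ℝ) ≤ B.rank * τ := le_mul_of_one_le_left hτ0 hdR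
  have hrad : ((τ * B.radius : ℝ≥0) : ℝ) ≤ 1 / 4 := by
    have h1 : (B.radius : ℝ) ≤ 2 := by exact_mod_cast hρ
    have h2 : (τ : ℝ) ≤ 1 / 8 := by nlinarith
    rw [NNReal.coe_mul]
    have := mul_le_mul h2 h1 B.radius.coe_nonneg (by norm_num)
    linarith
  set g : G → ℝ := conv (muFun A) (indFun L) with hg
  set f : G → ℝ := fun x => g x * (1 - g x) with hf
  -- Smoothing multiplies the sampling error by `4k`, and that error already carries a factor 2.
  set ε' := ε / (8 * k) with hε'
  have hε'0 : 0 < ε' := by positivity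
  set n := ⌈192 * m / ε' ^ 2⌉₊ with hn
  have hn1 : 192 * m ≤ n * ε' ^ 2 := by
    rw [← div_le_iff₀ (by positivity)]; exact Nat.le_ceil _
  have hn2 : (n : ℝ) ≤ 192 * m / ε' ^ 2 + 1 := (Nat.ceil_lt_add_one (by positivity)).le
  obtain ⟨X, hXS, hXcard, F, hF⟩ :=
    exists_translates_approx L B.carrier hm hε'0 hA hS hn1 hK hg hf
  have hXc : (0 : ℝ) < X.card := by
    by_contra! h
    have h0 : (X.card : ℝ) = 0 := le_antisymm h (Nat.cast_nonneg _)
    rw [h0, mul_zero] at hXcard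
    linarith
  have hX : X.Nonempty := Finset.card_pos.mp (by exact_mod_cast hXc)
  have hXB := hXS.trans hSB
  set l := ⌊8 * Real.log (4 * B'.carrier.card / X.card)⌋₊ + 1 with hl
  have hlog : Real.log (4 * B'.carrier.card / X.card) ≤ (n + 3) * Real.log (2 * K) + σ :=
    log_density_le hB'c hXc hSc hK1 hXcard
  have hlog0 : 0 ≤ Real.log (4 * B'.carrier.card / X.card) := by
    refine Real.log_nonneg ?_
    rw [one_le_div hXc]
    have : (X.card : ℝ) ≤ B'.carrier.card := by exact_mod_cast Finset.card_le_card hXB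
    linarith
  have hl1 : 8 * Real.log (4 * B'.carrier.card / X.card) < l := by
    rw [hl]; push_cast; exact Nat.lt_floor_add_one _
  have hl2 : (l : ℝ) ≤ 8 * ((n + 3) * Real.log (2 * K) + σ) + 1 := by
    have := Nat.floor_le (by positivity : 0 ≤ 8 * Real.log (4 * B'.carrier.card / X.card))
    rw [hl]; push_cast
    linarith
  have hl3 := rank_parameter_le hm hε hε1 hℓ hLk hσ hk hk1 hn2 hl2
  set Q := m * (1 / ε ^ 2) * ℓ ^ 2 * Real.log (2 * K) + σ with hQ
  have hl0 : 1 ≤ l := by rw [hl]; exact Nat.le_add_left _ _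
  have hl0R : (1 : ℝ) ≤ l := by exact_mod_cast hl0
  have hQ0 : 0 < Q := by linarith
  set κ := δ * Real.sqrt η / 8 with hκ
  have hκ0 : 0 < κ := by positivity
  have hκ1 : κ ≤ 1 := by
    have h1 : Real.sqrt η ≤ 1 := Real.sqrt_le_one.mpr hη1
    have := mul_le_one₀ hδ1.le hsη.le h1
    linarith
  obtain ⟨Λ, hΛcard, hΛ⟩ := exists_almost_annihilating hΓ hrad hBτreg hX hXB hl0 hl1 hκ0 hκ1
  have hden : 1 ≤ 93312 * (B.rank : ℝ) ^ 2 * l := by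
    have := one_le_mul_of_one_le_of_one_le (one_le_pow₀ hdR (n := 2)) hl0R
    linarith
  have hden0 : 0 < 93312 * (B.rank : ℝ) ^ 2 * l := by linarith
  -- The largest radius permitted by the local Chang theorem; passing to a regular radius below it
  -- loses at most 81.
  let R : ℝ≥0 := ⟨τ * B.radius * κ / (93312 * (B.rank : ℝ) ^ 2 * l), by positivity⟩
  have hR : (R : ℝ) = τ * B.radius * κ / (93312 * (B.rank : ℝ) ^ 2 * l) := rfl
  have hRle : (R : ℝ) ≤ τ * B.radius := by
    rw [hR, div_le_iff₀ hden0]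
    refine mul_le_mul_of_nonneg_left (hκ1.trans hden) (by positivity)
  obtain ⟨R', hR'1, hR'2, hTreg⟩ := BohrSet.exists_isRegular (Γ := B.freq ∪ Λ) (R := R)
    (hΓ.mono Finset.subset_union_left) (by
      rw [NNReal.coe_mul] at hrad; linarith)
  have hR'τ : R' ≤ τ * B.radius := hR'2.trans (by rw [← NNReal.coe_le_coe]; push_cast; exact hRle)
  set T : BohrSet G := ⟨B.freq ∪ Λ, R'⟩ with hT
  have hTB : T.carrier ⊆ B'.carrier := BohrSet.carrier_subset Finset.subset_union_left hR'τ
  have hTspec : ∀ γ : AddChar G ℂ, 1 / 2 ≤ ‖muHat X γ‖ → ∀ t ∈ T.carrier, ‖γ t - 1‖ ≤ κ := by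
    refine hΛ R' ?_
    have h1 : (R' : ℝ) ≤ R := by exact_mod_cast hR'2
    rw [hR, le_div_iff₀ hden0] at h1
    exact_mod_cast h1
  obtain ⟨a, ha, hasum⟩ := exists_conv_eq_sum_addChar (muFun A) (indFun L)
  rw [sqrt_mul_sqrt_eq_inv_sqrt hA hη] at hasum
  have hg0 : ∀ x, 0 ≤ g x := conv_muFun_nonneg _ (indFun_nonneg L)
  have hg1 : ∀ x, g x ≤ 1 := conv_muFun_le_one _ (indFun_le_one L)
  have htrans : ∀ t ∈ T.carrier, avgLpNorm (2 * m) B.carrier (fun x => g (x + t) - g x)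
      ≤ ε * avgLpNorm m B.carrier f ^ (1 / 2 : ℝ)
        + ε ^ (2 - 1 / m) * avgLpNorm 1 B.carrier f ^ (1 / (2 * m)) + δ := by
    intro t ht
    have h23 : (2 * k + 3 : ℝ) ≤ 17 * ℓ := by linarith
    have hs : 12 * (B.rank : ℝ) * ((2 * k + 3) * τ) ≤ 204 * (B.rank * τ * ℓ) := by
      have := mul_le_mul_of_nonneg_left h23 hdτ
      linarith
    have hs1 : (2 * k + 3) * (τ : ℝ) ≤ 1 / (12 * B.rank) := by
      rw [le_div_iff₀ (by positivity)]
      linarith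
    have hs2 : (1 : ℝ) / (12 * B.rank) ≤ 1 := by
      rw [div_le_one (by positivity)]; linarith
    have hmain := lpSum_translate_sub_le (by linarith : 1 ≤ 2 * m) (hs1.trans hs2) hX hXB hF
      (fun x y => by
        rw [abs_le]
        constructor <;> linarith [hg0 x, hg0 y, hg1 x, hg1 y])
      (hTB ht) (by positivity : 0 ≤ δ / 4)
      (fun x => (abs_diffAverage_iterate_sub_le X ha hasum hκ0.le
        (fun γ hγ => hTspec γ hγ t ht) k x).trans hkbound)
      (by positivity : 0 ≤ δ / 4)
      ((BohrSet.card_sdiff_le_of_isRegular hBreg (by positivity) hs1).trans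
        (mul_le_mul_of_nonneg_right (hs.trans hb2) (Nat.cast_nonneg _)))
    refine avgLpNorm_rescale hm B.carrier_nonempty _ f (hmain.trans ?_)
    have h8 : (1 : ℝ) ≤ 8 * k := by linarith
    have hsc := mul_rpow_scale_le hm hε h8
    have hsc1 : 8 * k * ε' = ε := by rw [hε']; field_simp
    have hu : 0 ≤ lpSum 1 B.carrier f ^ (1 / (2 * m)) := Real.rpow_nonneg (lpSum_nonneg _ _ _) _
    have hw : 0 ≤ (B.carrier.card : ℝ) ^ (1 / (2 * m)) := by positivity
    have h9 := mul_le_mul_of_nonneg_right hsc hu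
    have h10 := mul_nonneg hδ.le hw
    have e : 4 * (k : ℝ) * (2 * (ε' * lpSum m B.carrier f ^ (1 / 2 : ℝ)
        + ε' ^ (2 - 1 / m) * lpSum 1 B.carrier f ^ (1 / (2 * m))))
        = (8 * k * ε') * lpSum m B.carrier f ^ (1 / 2 : ℝ)
          + 8 * k * ε' ^ (2 - 1 / m) * lpSum 1 B.carrier f ^ (1 / (2 * m)) := by ring
    rw [e, hsc1]
    linarith
  -- The value of `d'` is far above the number `l` of new frequencies because it also sits in the
  -- denominator of the radius bound, where it must exceed `8 · 93312 · 81 · l`.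
  refine ⟨10 ^ 15 * Q, T, by positivity, le_rfl, hTreg, ⟨Finset.subset_union_left, hR'τ⟩, ?_, ?_,
    htrans, ?_⟩
  · have h1 : (T.rank : ℝ) ≤ B.rank + l := by
      have h2 : T.rank ≤ B.rank + Λ.card := Finset.card_union_le _ _
      exact_mod_cast h2.trans (Nat.add_le_add_left hΛcard _)
    linarith
  · refine le_trans ?_ hR'1
    rw [hR, ← Real.sqrt_eq_rpow]
    exact radius_parameter_le B.radius.coe_nonneg hτ0 hδ.le hsη.le (by linarith) (by linarith) hl3
  · exact avgLpNorm_conv_muFun_sub_le (by linarith) T.carrier_nonempty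
      (fun t ht => BohrSet.neg_mem_carrier ht) htrans
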